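/- Let $\dot{\mathbb R}=\mathbb R\setminus\{0\}$, $\lambda<0$ and $\nu=\sqrt{\tfrac14+\lambda}$ (principal root), so that $\nu$ is real if $-\tfrac14\le\lambda<0$ and purely imaginary if $\lambda<-\tfrac14$. Let $H^{(2)}_\nu$ be the Hankel function of the second kind, $\Theta$ the Heaviside step function, and $$G(t,x,y)=\frac{\Theta(xy)\sqrt{xy}}{4i^{\nu+1}t}\,e^{-\frac{x^2+y^2}{4it}}\,H^{(2)}_\nu\Big(\frac{xy}{2t}\Big),\qquad t>0,\ x,y\in\dot{\mathbb R}.$$ For $\alpha\in(0,\frac\pi2)$ and $h>0$ put $$D_{\alpha,h}=\{z\neq0:\operatorname{Arg}z\in[-\alpha,\alpha],\ \Im z\ge-h\}\cup\{z\neq0:\operatorname{Arg}z\in[\pi-\alpha,\pi+\alpha],\ \Im z\le h\}.$$ A function $f$ on an open interval $I$ belongs to $\mathrm{AC}(I)$ if $f(y)-f(x)=\int_x^y g(s)\,ds$, $x,y\in I$, for some $g\in L^1_{\mathrm{loc}}(I)$; $\mathrm{AC}(\dot{\mathbb R})$ consists of the functions that are in $\mathrm{AC}$ on both $(-\infty,0)$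 and $(0,\infty)$; and $\mathrm{AC}_{1,2}((0,T)\times\dot{\mathbb R})$ consists of the functions $\Psi$ with $\Psi(\cdot,x)\in\mathrm{AC}((0,T))$ for all $x\in\dot{\mathbb R}$ and $\Psi(t,\cdot),\Psi_x(t,\cdot)\in\mathrm{AC}(\dot{\mathbb R})$ for all $t\in(0,T)$. Then for all $T\in(0,\infty]$, $\alpha\in(0,\frac\pi2)$ and $h>0$, $G$ is a Green's function of the attractive centrifugal potential $V(t,x)=\lambda/x^2$ with Dirichlet conditions (transmission matrices $M=I$, $N=0$) in the following sense. $G$ has a continuation $G:(0,T)\times\dot{\mathbb R}\times D_{\alpha,h}\to\mathbb C$ such that $G(t,x,\cdot)$ is continuous on $D_{\alpha,h}$ and holomorphic on $\operatorname{int}D_{\alpha,h}$ for all $t\in(0,T)$, $x\in\dot{\mathbb R}$, and: (i) for every $z\in D_{\alpha,h}$, $G(\cdot,\cdot,z)\in\mathrm{AC}_{1,2}((0,T)\times\dot{\mathbb R})$ and $$i\,\partial_tG(t,x,z)=\Big(-\partial_x^2+\frac{\lambda}{x^2}\Big)G(t,x,z)\quad\text{for almost every }(t,x)\in(0,T)\times\dot{\mathbb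 R};$$ moreover $G(t,0^+,y)=G(t,0^-,y)=0$ for all $t\in(0,T)$, $y\in\dot{\mathbb R}$; and there is $a\in\mathrm{AC}((0,T))$ with $a(t)>0$ and $\lim_{t\to0^+}a(t)=\infty$ such that (ii) $\displaystyle\lim_{t\to0^+}\frac{G(t,x,x)}{\sqrt{a(t)}}=\frac1{\sqrt{i\pi}}$ for every $x\in\dot{\mathbb R}$; (iii) there are $p\in(0,2)$ and continuous functions $A_0,A_1,A_2,B_0,B_1,B_2:(0,T)\times\dot{\mathbb R}\to[0,\infty)$ such that the function $\widetilde G$ defined by $G(t,x,z)=e^{ia(t)(z-x)^2}\widetilde G(t,x,z)$ satisfies, for all $t\in(0,T)$, $x\in\dot{\mathbb R}$, $z\in D_{\alpha,h}$, $$|\widetilde G|\le A_0e^{B_0|z|^p},\qquad|\partial_x\widetilde G|\le A_1e^{B_1|z|^p},\qquad|\partial_x^2\widetilde G|,\ |\partial_t\widetilde G|\le A_2e^{B_2|z|^p},$$ with coefficients evaluated at $(t,x)$; for every $x\in\dot{\mathbb R}$ the functions $A_0(\cdot,x)/\sqrt{a}$ and $B_0(\cdot,x)$ are bounded as $t\to0^+$,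 and for every $t\in(0,T)$ the functions $A_0(t,\cdot)$ and $B_0(t,\cdot)$ are bounded as $x\to0^\pm$. -/

import Mathlib

open Filter Topology Set MeasureTheory

noncomputable section

namespace CentrifugalGreen

/-- The Bessel function of the first kind of complex order `ν`,
`J_ν(w) = ∑ₖ (-1)ᵏ / (k! Γ(ν + k + 1)) (w/2)^(2k+ν)`, on the principal branch
(`1/Γ` vanishes at the poles of `Γ`, as it does in Mathlib). -/
def besselJ (ν w : ℂ) : ℂ :=
  (w / 2) ^ ν * ∑' k : ℕ,
    ((-1 : ℂ) ^ k / ((k.factorial : ℂ) * Complex.Gamma (ν + k + 1))) * (w / 2) ^ (2 * k)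

/-- The quotient `(J_ν cos(πν) - J_{-ν}) / sin(πν)`, meaningful for non-integer `ν`. -/
def besselYQuot (ν w : ℂ) : ℂ :=
  (besselJ ν w * Complex.cos (Real.pi * ν) - besselJ (-ν) w) / Complex.sin (Real.pi * ν)

open Classical in
/-- The Bessel function of the second kind; for integer order the quotient is replaced by its
limiting value. -/
def besselY (ν w : ℂ) : ℂ :=
  if ∃ n : ℤ, ν = n then limUnder (𝓝[≠] ν) (fun μ : ℂ => besselYQuot μ w) else besselYQuot ν w

/-- The Hankel function of the second kind, `H_ν^{(2)} = J_ν - i Y_ν`. -/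
def hankelH2 (ν w : ℂ) : ℂ := besselJ ν w - Complex.I * besselY ν w

/-- The order `ν = √(1/4 + λ)` (principal square root). -/
def order (lam : ℝ) : ℂ := Complex.sqrt ((1 / 4 + lam : ℝ) : ℂ)

/-- The Heaviside step function. -/
def step (s : ℝ) : ℝ := if 0 < s then 1 else 0

/-- The kernel
`Θ(xy) √(xy) / (4 i^{ν+1} t) · exp(-(x² + y²)/(4 i t)) · H_ν^{(2)}(xy/(2t))`, `ν = √(1/4 + λ)`. -/
def greenFunction (lam : ℝ) (t x y : ℝ) : ℂ :=
  ((step (x * y) * Real.sqrt (x * y) : ℝ) : ℂ) / (4 * Complex.I ^ (order lam + 1) * t) *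
    Complex.exp (-((x : ℂ) ^ 2 + (y : ℂ) ^ 2) / (4 * Complex.I * t)) *
    hankelH2 (order lam) ((x : ℂ) * y / (2 * t))

/-- The domain `D_{α,h}`: `z ≠ 0` with `Arg z ∈ [-α, α]`, `Im z ≥ -h`, or with
`Arg z ∈ [π - α, π + α]`, i.e. `Arg (-z) ∈ [-α, α]`, and `Im z ≤ h`. -/
def domainD (α h : ℝ) : Set ℂ :=
  {z | z ≠ 0 ∧ Complex.arg z ∈ Icc (-α) α ∧ -h ≤ z.im} ∪
    {z | z ≠ 0 ∧ Complex.arg (-z) ∈ Icc (-α) α ∧ z.im ≤ h}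

/-- The time interval `(0, T)`, `T ∈ (0, ∞]`. -/
def timeInterval (T : EReal) : Set ℝ := {t | 0 < t ∧ (t : EReal) < T}

/-- Absolute continuity on an open interval `I`: `f` is a primitive of a locally integrable
function. -/
def AC {E : Type*} [NormedAddCommGroup E] [NormedSpace ℝ E] (f : ℝ → E) (I : Set ℝ) : Prop :=
  ∃ g : ℝ → E, LocallyIntegrableOn g I ∧ ∀ x ∈ I, ∀ y ∈ I, f y - f x = ∫ s in x..y, g s

/-- Absolute continuity on `ℝ \ {0}`, i.e. on both open half-lines. -/
def ACPunctured (f : ℝ → ℂ) : Prop := AC f (Iio 0) ∧ AC f (Ioi 0)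

/-- The space `AC_{1,2}((0,T) × (ℝ \ {0}))`. -/
def AC12 (T : EReal) (Ψ : ℝ → ℝ → ℂ) : Prop :=
  (∀ x : ℝ, x ≠ 0 → AC (fun t => Ψ t x) (timeInterval T)) ∧
  ∀ t ∈ timeInterval T, ACPunctured (Ψ t) ∧ ACPunctured (deriv (Ψ t))

/-- `i ∂ₜΨ = (-∂ₓ² + V) Ψ` for almost every `(t, x) ∈ (0,T) × (ℝ \ {0})`, where the derivatives
are required to exist. -/
def SolvesSchroedinger (T : EReal) (V Ψ : ℝ → ℝ → ℂ) : Prop :=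
  ∀ᵐ p : ℝ × ℝ, p.1 ∈ timeInterval T → p.2 ≠ 0 →
    DifferentiableAt ℝ (fun t => Ψ t p.2) p.1 ∧
    DifferentiableAt ℝ (Ψ p.1) p.2 ∧
    DifferentiableAt ℝ (deriv (Ψ p.1)) p.2 ∧
    Complex.I * deriv (fun t => Ψ t p.2) p.1 =
      -deriv (deriv (Ψ p.1)) p.2 + V p.1 p.2 * Ψ p.1 p.2

/-- The transmission condition `M (f(0⁺), f(0⁻)) = N (f'(0⁺), -f'(0⁻))`. One-sided limits of `f`
(of `f'`) have to exist as soon as they enter the condition, that is if `M ≠ 0` (if `N ≠ 0`). -/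
def Transmission (M N : Matrix (Fin 2) (Fin 2) ℂ) (f : ℝ → ℂ) : Prop :=
  ∃ fp fm dp dm : ℂ,
    (M ≠ 0 → Tendsto f (𝓝[>] 0) (𝓝 fp) ∧ Tendsto f (𝓝[<] 0) (𝓝 fm)) ∧
    (N ≠ 0 → Tendsto (deriv f) (𝓝[>] 0) (𝓝 dp) ∧ Tendsto (deriv f) (𝓝[<] 0) (𝓝 dm)) ∧
    M.mulVec ![fp, fm] = N.mulVec ![dp, -dm]

/-- The factor `G̃` in the decomposition `G(t,x,z) = e^{i a(t) (z-x)²} G̃(t,x,z)`. -/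
def reduced (a : ℝ → ℝ) (G : ℝ → ℝ → ℂ → ℂ) (t x : ℝ) (z : ℂ) : ℂ :=
  Complex.exp (-(Complex.I * a t * (z - x) ^ 2)) * G t x z

/-- A function of `(t, x)` is an admissible coefficient if it is nonnegative and continuous on
`(0,T) × (ℝ \ {0})`. -/
def IsCoefficient (T : EReal) (A : ℝ → ℝ → ℝ) : Prop :=
  (∀ t ∈ timeInterval T, ∀ x : ℝ, x ≠ 0 → 0 ≤ A t x) ∧
  ContinuousOn (fun p : ℝ × ℝ => A p.1 p.2) (timeInterval T ×ˢ {0}ᶜ)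

/-- The exponential bounds on `G̃` and its derivatives, for given `a` and exponent `p`, together
with the boundedness requirements on the coefficients as `t → 0⁺` and as `x → 0±`. -/
def ExponentialBounds (T : EReal) (M N : Matrix (Fin 2) (Fin 2) ℂ) (D : Set ℂ)
    (G : ℝ → ℝ → ℂ → ℂ) (a : ℝ → ℝ) (p : ℝ) : Prop :=
  ∃ A₀ A₁ A₂ B₀ B₁ B₂ : ℝ → ℝ → ℝ,
    (IsCoefficient T A₀ ∧ IsCoefficient T A₁ ∧ IsCoefficient T A₂ ∧
      IsCoefficient T B₀ ∧ IsCoefficient T B₁ ∧ IsCoefficient T B₂) ∧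
    (∀ t ∈ timeInterval T, ∀ x : ℝ, x ≠ 0 → ∀ z ∈ D,
      ‖reduced a G t x z‖ ≤ A₀ t x * Real.exp (B₀ t x * ‖z‖ ^ p) ∧
      ‖deriv (fun ξ => reduced a G t ξ z) x‖ ≤ A₁ t x * Real.exp (B₁ t x * ‖z‖ ^ p) ∧
      ‖deriv (deriv (fun ξ => reduced a G t ξ z)) x‖ ≤ A₂ t x * Real.exp (B₂ t x * ‖z‖ ^ p) ∧
      ‖deriv (fun τ => reduced a G τ x z) t‖ ≤ A₂ t x * Real.exp (B₂ t x * ‖z‖ ^ p)) ∧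
    (∀ x : ℝ, x ≠ 0 →
      IsBoundedUnder (· ≤ ·) (𝓝[>] 0) (fun t => A₀ t x / Real.sqrt (a t)) ∧
      IsBoundedUnder (· ≤ ·) (𝓝[>] 0) (fun t => B₀ t x)) ∧
    (∀ t ∈ timeInterval T,
      (M ≠ 0 ∨ N ≠ 0 →
        IsBoundedUnder (· ≤ ·) (𝓝[≠] 0) (A₀ t) ∧ IsBoundedUnder (· ≤ ·) (𝓝[≠] 0) (B₀ t)) ∧
      (N ≠ 0 →
        IsBoundedUnder (· ≤ ·) (𝓝[≠] 0) (A₁ t) ∧ IsBoundedUnder (· ≤ ·) (𝓝[≠] 0) (B₁ t)))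

/-- The properties required of a Green's function `G : (0,T) × (ℝ\{0}) × (ℝ\{0}) → ℂ` for the
potential `V` and the transmission matrices `M`, `N`, with continuation in the last variable to
`D ⊆ ℂ` and with the initial condition in the form `G(t,x,x)/√a(t) → 1/√(iπ)`. -/
def GreenAssumption (T : EReal) (V : ℝ → ℝ → ℂ) (M N : Matrix (Fin 2) (Fin 2) ℂ) (D : Set ℂ)
    (G : ℝ → ℝ → ℝ → ℂ) : Prop :=
  ∃ Gc : ℝ → ℝ → ℂ → ℂ,
    -- `Gc` continues `G`, is continuous on `D` and holomorphic in its interior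
    (∀ t ∈ timeInterval T, ∀ x : ℝ, x ≠ 0 →
      (∀ y : ℝ, y ≠ 0 → Gc t x y = G t x y) ∧
      ContinuousOn (Gc t x) D ∧ DifferentiableOn ℂ (Gc t x) (interior D)) ∧
    -- Schrödinger equation
    (∀ z ∈ D, AC12 T (fun t x => Gc t x z) ∧ SolvesSchroedinger T V (fun t x => Gc t x z)) ∧
    -- transmission condition
    (∀ y : ℝ, y ≠ 0 → ∀ t ∈ timeInterval T, Transmission M N (fun x => G t x y)) ∧
    ∃ a : ℝ → ℝ,
      AC a (timeInterval T) ∧ (∀ t ∈ timeInterval T, 0 < a t) ∧ Tendsto a (𝓝[>] 0) atTop ∧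
      -- initial condition
      (∀ x : ℝ, x ≠ 0 →
        Tendsto (fun t => G t x x / (Real.sqrt (a t) : ℂ)) (𝓝[>] 0)
          (𝓝 (1 / Complex.sqrt (Complex.I * Real.pi)))) ∧
      -- exponential bounds
      ∃ p ∈ Ioo (0 : ℝ) 2, ExponentialBounds T M N D Gc a p

end CentrifugalGreen

end

/-!
With `q = ν - 1/2`, the function `√w H_ν⁽²⁾(w)` is a constant multiple of `e^{-iw} k(iw)`, where
`k(s) = ∫₀^∞ e^{-u} u^q (1 + u/(2s))^q du`. Indeed `e^{-s} k(s)` and the normalised power series of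
the Bessel functions of order `±ν` all solve `u'' = (1 + (ν² - 1/4)/s²) u` on the slit plane, so
their mutual Wronskians are constants, which are read off as `s → ∞` and `s → 0⁺`; this gives the
connection formula for `ν ≠ 0`, and `ν = 0` follows by continuity in the order.

Hence `G(t, x, z) = e^{i(z-x)²/(4t)} c t^{-1/2} k(ixz/(2t))` where `x` and `Re z` have the same
sign, and all claims hold with `a(t) = 1/(4t)`, `p = 1` and `B_j = 0`. The limit
`k(s) → Γ(ν + 1/2)` as `s → ∞` gives the initial condition, and `k(s) → 0` as `s → 0`, which
holds because `Re q < 0`, gives the Dirichlet condition. On the values of `s` that occur,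
`1 + u/(2s)` stays away from the origin, which bounds `k(s)`, `s k'(s)` and `s² k''(s)` uniformly.
-/

noncomputable section

namespace CentrifugalGreen

/-! ### Laplace-type integrals -/

/-- The integrand of `laplaceInt`. -/
def laplaceIntegrand (q b z : ℂ) (u : ℝ) : ℂ :=
  (Real.exp (-u) : ℂ) * (u : ℂ) ^ q * (1 + u / (2 * z)) ^ b

/-- The integral `∫₀^∞ e^{-u} u^q (1 + u/(2z))^b du`. For `b = q = ν - 1/2` it is, up to elementary
factors, the modified Bessel function `K_ν(z)`. -/
def laplaceInt (q b z : ℂ) : ℂ := ∫ u in Ioi (0 : ℝ), laplaceIntegrand q b z u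

/-- The points `1 + u/(2z)`, `u > 0`, stay at distance at least `c` from the origin. On sets of `z`
with this property the integrands of `laplaceInt` have a common majorant. -/
def RayBound (c : ℝ) (z : ℂ) : Prop := ∀ u : ℝ, 0 < u → c ≤ ‖1 + (u : ℂ) / (2 * z)‖

/-- The common majorant of the integrands of `laplaceInt q b z` for `z` with `RayBound c z`. -/
def laplaceMajorant (q b : ℂ) (c u : ℝ) : ℝ :=
  Real.exp (-u) * u ^ q.re * (c ^ b.re * Real.exp (Real.pi * |b.im|))

/-- The resulting bound on `laplaceInt q b z` for `z` with `RayBound c z`. -/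
def laplaceBound (q b : ℂ) (c : ℝ) : ℝ := ∫ u in Ioi (0 : ℝ), laplaceMajorant q b c u

lemma re_sub_one_nonpos {b : ℂ} (hb : b.re ≤ 0) : (b - 1).re ≤ 0 := by
  rw [Complex.sub_re, Complex.one_re]; linarith

lemma neg_one_lt_re_add_one {q : ℂ} (hq : -1 < q.re) : -1 < (q + 1).re := by
  rw [Complex.add_re, Complex.one_re]; linarith

lemma one_add_div_re (u : ℝ) (z : ℂ) :
    (1 + (u : ℂ) / (2 * z)).re = 1 + u / 2 * (z.re / Complex.normSq z) := by
  rw [show (u : ℂ) / (2 * z) = ((u / 2 : ℝ) : ℂ) * z⁻¹ by push_cast; ring]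
  simp [Complex.inv_re]

lemma one_add_div_im (u : ℝ) (z : ℂ) :
    (1 + (u : ℂ) / (2 * z)).im = -(u / 2 * (z.im / Complex.normSq z)) := by
  rw [show (u : ℂ) / (2 * z) = ((u / 2 : ℝ) : ℂ) * z⁻¹ by push_cast; ring]
  simp [Complex.inv_im, neg_div]

lemma one_add_div_mem_slitPlane {z : ℂ} (hz : z ∈ Complex.slitPlane) {u : ℝ} (hu : 0 < u) :
    1 + (u : ℂ) / (2 * z) ∈ Complex.slitPlane := by
  have hn : 0 < Complex.normSq z := Complex.normSq_pos.2 (Complex.slitPlane_ne_zero hz)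
  rw [Complex.mem_slitPlane_iff, one_add_div_re, one_add_div_im]
  rcases Complex.mem_slitPlane_iff.1 hz with h | h
  · left; positivity
  · right; exact neg_ne_zero.2 (by positivity)

lemma one_add_div_ne_zero {z : ℂ} (hz : z ∈ Complex.slitPlane) {u : ℝ} (hu : 0 < u) :
    1 + (u : ℂ) / (2 * z) ≠ 0 :=
  Complex.slitPlane_ne_zero (one_add_div_mem_slitPlane hz hu)

lemma rayBound_one {z : ℂ} (hz : 0 ≤ z.re) : RayBound 1 z := by
  intro u hu
  refine le_trans ?_ (Complex.re_le_norm _)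
  rw [one_add_div_re]
  have : 0 ≤ u / 2 * (z.re / Complex.normSq z) :=
    mul_nonneg (by positivity) (div_nonneg hz (Complex.normSq_nonneg z))
  linarith

lemma rayBound_of_le_abs_im {c : ℝ} {z : ℂ} (hz0 : z ≠ 0) (h : c * ‖z‖ ≤ |z.im|) :
    RayBound c z := by
  intro u _
  have hsplit : 1 + (u : ℂ) / (2 * z) = (z + ((u / 2 : ℝ) : ℂ)) / z := by
    push_cast; field_simp
  rw [hsplit, norm_div, le_div_iff₀ (norm_pos_iff.2 hz0)]
  simpa using h.trans (Complex.abs_im_le_norm (z + ((u / 2 : ℝ) : ℂ)) |>.trans' (by simp))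

lemma eventually_rayBound {z : ℂ} (hz : z ∈ Complex.slitPlane) :
    ∃ c : ℝ, 0 < c ∧ ∀ᶠ w in 𝓝 z, RayBound c w := by
  have hz0 : z ≠ 0 := Complex.slitPlane_ne_zero hz
  rcases Complex.mem_slitPlane_iff.1 hz with hre | him
  · refine ⟨1, one_pos, ?_⟩
    filter_upwards [Complex.continuous_re.continuousAt.eventually (lt_mem_nhds hre)] with w hw
    exact rayBound_one hw.le
  · have hzn : 0 < ‖z‖ := norm_pos_iff.2 hz0
    have him : 0 < |z.im| := abs_pos.2 him
    refine ⟨|z.im| / (2 * ‖z‖), by positivity, ?_⟩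
    have hlt : |z.im| / (2 * ‖z‖) * ‖z‖ < |z.im| := by
      rw [div_mul_eq_mul_div, mul_div_mul_right _ _ hzn.ne']
      exact half_lt_self him
    have hopen : IsOpen {w : ℂ | |z.im| / (2 * ‖z‖) * ‖w‖ < |w.im|} :=
      isOpen_lt (by fun_prop) Complex.continuous_im.abs
    filter_upwards [hopen.mem_nhds hlt, isOpen_ne.mem_nhds hz0] with w hw hw0
    exact rayBound_of_le_abs_im hw0 hw.le

lemma norm_cpow_le_of_le_norm {c : ℝ} (hc : 0 < c) {p b : ℂ} (hp : c ≤ ‖p‖) (hb : b.re ≤ 0) :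
    ‖p ^ b‖ ≤ c ^ b.re * Real.exp (Real.pi * |b.im|) := by
  have hp0 : p ≠ 0 := norm_pos_iff.1 (hc.trans_le hp)
  rw [Complex.norm_cpow_of_ne_zero hp0, div_eq_mul_inv, ← Real.exp_neg]
  refine mul_le_mul (Real.rpow_le_rpow_of_nonpos hc hp hb) (Real.exp_le_exp.2 ?_)
    (Real.exp_pos _).le (by positivity)
  calc -(p.arg * b.im) ≤ |p.arg * b.im| := neg_le_abs _
    _ = |p.arg| * |b.im| := abs_mul _ _
    _ ≤ _ := by gcongr; exact Complex.abs_arg_le_pi _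

lemma norm_laplaceIntegrand_le {c : ℝ} (hc : 0 < c) (q : ℂ) {b z : ℂ} (hz : RayBound c z)
    (hb : b.re ≤ 0) {u : ℝ} (hu : 0 < u) :
    ‖laplaceIntegrand q b z u‖ ≤ laplaceMajorant q b c u := by
  rw [laplaceIntegrand, norm_mul, norm_mul, Complex.norm_cpow_eq_rpow_re_of_pos hu,
    Complex.norm_real, Real.norm_of_nonneg (Real.exp_pos _).le]
  exact mul_le_mul_of_nonneg_left (norm_cpow_le_of_le_norm hc (hz u hu) hb) (by positivity)

lemma integrableOn_exp_mul_rpow {r : ℝ} (hr : -1 < r) :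
    IntegrableOn (fun u : ℝ => Real.exp (-u) * u ^ r) (Ioi 0) := by
  simpa using Real.GammaIntegral_convergent (s := r + 1) (by linarith)

lemma Gamma_add_one_eq_integral {q : ℂ} (hq : -1 < q.re) :
    Complex.Gamma (q + 1) = ∫ u in Ioi (0 : ℝ), (Real.exp (-u) : ℂ) * (u : ℂ) ^ q := by
  have : 0 < (q + 1).re := by rw [Complex.add_re, Complex.one_re]; linarith
  rw [Complex.Gamma_eq_integral this, Complex.GammaIntegral]
  simp

lemma integrableOn_laplaceMajorant {q : ℂ} (hq : -1 < q.re) (b : ℂ) (c : ℝ) :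
    IntegrableOn (laplaceMajorant q b c) (Ioi 0) :=
  (integrableOn_exp_mul_rpow hq).mul_const _

lemma laplaceBound_nonneg (q b : ℂ) {c : ℝ} (hc : 0 < c) : 0 ≤ laplaceBound q b c :=
  setIntegral_nonneg measurableSet_Ioi fun u (hu : 0 < u) => by
    rw [laplaceMajorant]; positivity

lemma continuousOn_laplaceIntegrand (q b : ℂ) {z : ℂ} (hz : z ∈ Complex.slitPlane) :
    ContinuousOn (laplaceIntegrand q b z) (Ioi 0) := by
  intro u hu
  apply ContinuousAt.continuousWithinAt
  refine (ContinuousAt.mul (by fun_prop) ?_).mul ?_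
  · exact Complex.continuous_ofReal.continuousAt.cpow continuousAt_const
      (Complex.ofReal_mem_slitPlane.2 hu)
  · exact ContinuousAt.cpow (by fun_prop) continuousAt_const (one_add_div_mem_slitPlane hz hu)

lemma aestronglyMeasurable_laplaceIntegrand (q b : ℂ) {z : ℂ} (hz : z ∈ Complex.slitPlane) :
    AEStronglyMeasurable (laplaceIntegrand q b z) (volume.restrict (Ioi 0)) :=
  (continuousOn_laplaceIntegrand q b hz).aestronglyMeasurable measurableSet_Ioi

lemma integrableOn_laplaceIntegrand {q b z : ℂ} (hq : -1 < q.re) (hb : b.re ≤ 0)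
    (hz : z ∈ Complex.slitPlane) : IntegrableOn (laplaceIntegrand q b z) (Ioi 0) := by
  obtain ⟨c, hc, h⟩ := eventually_rayBound hz
  refine Integrable.mono' (integrableOn_laplaceMajorant hq b c)
    (aestronglyMeasurable_laplaceIntegrand q b hz) ?_
  filter_upwards [ae_restrict_mem measurableSet_Ioi] with u hu
  exact norm_laplaceIntegrand_le hc q h.self_of_nhds hb hu

lemma norm_laplaceInt_le {c : ℝ} (hc : 0 < c) {q b z : ℂ} (hq : -1 < q.re) (hb : b.re ≤ 0)
    (hz : RayBound c z) : ‖laplaceInt q b z‖ ≤ laplaceBound q b c := by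
  refine norm_integral_le_of_norm_le (integrableOn_laplaceMajorant hq b c) ?_
  filter_upwards [ae_restrict_mem measurableSet_Ioi] with u hu
  exact norm_laplaceIntegrand_le hc q hz hb hu

lemma hasDerivAt_laplaceIntegrand (q b : ℂ) {z : ℂ} (hz : z ∈ Complex.slitPlane) {u : ℝ}
    (hu : 0 < u) :
    HasDerivAt (fun w => laplaceIntegrand q b w u)
      (-(b / (2 * z ^ 2)) * laplaceIntegrand (q + 1) (b - 1) z u) z := by
  have hz0 : z ≠ 0 := Complex.slitPlane_ne_zero hz
  have hu0 : (u : ℂ) ≠ 0 := Complex.ofReal_ne_zero.2 hu.ne'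
  have hinner : HasDerivAt (fun w : ℂ => 1 + (u : ℂ) / (2 * w)) (-(u / (2 * z ^ 2))) z := by
    refine (((hasDerivAt_inv hz0).const_mul ((u : ℂ) / 2)).const_add 1).congr_deriv ?_
      |>.congr_of_eventuallyEq (Eventually.of_forall fun w => ?_)
    · field_simp
    · ring
  refine ((hinner.cpow_const (c := b) (one_add_div_mem_slitPlane hz hu)).const_mul
    ((Real.exp (-u) : ℂ) * (u : ℂ) ^ q)).congr_deriv ?_
  rw [laplaceIntegrand, Complex.cpow_add _ _ hu0, Complex.cpow_one]
  ring

lemma hasDerivAt_laplaceInt {q b z : ℂ} (hq : -1 < q.re) (hb : b.re ≤ 0)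
    (hz : z ∈ Complex.slitPlane) :
    HasDerivAt (laplaceInt q b) (-(b / (2 * z ^ 2)) * laplaceInt (q + 1) (b - 1) z) z := by
  obtain ⟨c, hc, hray⟩ := eventually_rayBound hz
  have hb1 : (b - 1).re ≤ 0 := re_sub_one_nonpos hb
  have hq1 : -1 < (q + 1).re := neg_one_lt_re_add_one hq
  obtain ⟨K, hK⟩ : ∃ K : ℝ, ∀ᶠ w in 𝓝 z, ‖-(b / (2 * w ^ 2))‖ ≤ K := by
    have : ContinuousAt (fun w : ℂ => ‖-(b / (2 * w ^ 2))‖) z := by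
      have : z ≠ 0 := Complex.slitPlane_ne_zero hz
      fun_prop (disch := simpa)
    exact ⟨_, this.eventually_le_const (lt_add_one _)⟩
  obtain ⟨s, hs, hsub⟩ :=
    ((hray.and hK).and (Complex.isOpen_slitPlane.mem_nhds hz)).exists_mem
  refine (hasDerivAt_integral_of_dominated_loc_of_deriv_le (𝕜 := ℂ)
    (F := fun w u => laplaceIntegrand q b w u)
    (F' := fun w u => -(b / (2 * w ^ 2)) * laplaceIntegrand (q + 1) (b - 1) w u)
    (bound := fun u => K * laplaceMajorant (q + 1) (b - 1) c u) hs
    ?_ (integrableOn_laplaceIntegrand hq hb hz)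
    ((aestronglyMeasurable_laplaceIntegrand _ _ hz).const_mul _) ?_
    ((integrableOn_laplaceMajorant hq1 _ _).const_mul _) ?_).2.congr_deriv
    (integral_const_mul _ _)
  · filter_upwards [Complex.isOpen_slitPlane.mem_nhds hz] with w hw
    exact aestronglyMeasurable_laplaceIntegrand q b hw
  · filter_upwards [ae_restrict_mem measurableSet_Ioi] with u hu w hw
    obtain ⟨⟨hray, hK⟩, -⟩ := hsub w hw
    rw [norm_mul]
    exact mul_le_mul hK (norm_laplaceIntegrand_le hc _ hray hb1 hu) (norm_nonneg _)
      ((norm_nonneg _).trans hK)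
  · filter_upwards [ae_restrict_mem measurableSet_Ioi] with u hu w hw
    exact hasDerivAt_laplaceIntegrand q b (hsub w hw).2 hu

lemma laplaceIntegrand_succ (q b : ℂ) {z : ℂ} (hz : z ∈ Complex.slitPlane) {u : ℝ} (hu : 0 < u) :
    laplaceIntegrand (q + 1) (b - 1) z u =
      2 * z * (laplaceIntegrand q b z u - laplaceIntegrand q (b - 1) z u) := by
  have hz0 : z ≠ 0 := Complex.slitPlane_ne_zero hz
  have hu0 : (u : ℂ) ≠ 0 := Complex.ofReal_ne_zero.2 hu.ne'
  have hb : (1 + (u : ℂ) / (2 * z)) ^ b =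
      (1 + (u : ℂ) / (2 * z)) ^ (b - 1) * (1 + (u : ℂ) / (2 * z)) := by
    rw [Complex.cpow_sub _ _ (one_add_div_ne_zero hz hu), Complex.cpow_one,
      div_mul_cancel₀ _ (one_add_div_ne_zero hz hu)]
  simp only [laplaceIntegrand]
  rw [hb, Complex.cpow_add _ _ hu0, Complex.cpow_one]
  field_simp
  ring

lemma laplaceInt_succ {q b z : ℂ} (hq : -1 < q.re) (hb : b.re ≤ 0) (hz : z ∈ Complex.slitPlane) :
    laplaceInt (q + 1) (b - 1) z = 2 * z * (laplaceInt q b z - laplaceInt q (b - 1) z) := by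
  have hb1 : (b - 1).re ≤ 0 := re_sub_one_nonpos hb
  simp only [laplaceInt]
  rw [← integral_sub (integrableOn_laplaceIntegrand hq hb hz)
    (integrableOn_laplaceIntegrand hq hb1 hz), ← integral_const_mul]
  exact setIntegral_congr_fun measurableSet_Ioi fun u hu => laplaceIntegrand_succ q b hz hu

lemma hasDerivAt_laplaceIntegrand_right (q b : ℂ) {z : ℂ} (hz : z ∈ Complex.slitPlane) {u : ℝ}
    (hu : 0 < u) :
    HasDerivAt (laplaceIntegrand (q + 1) b z)
      (-laplaceIntegrand (q + 1) b z u + (q + 1) * laplaceIntegrand q b z u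
        + b / (2 * z) * laplaceIntegrand (q + 1) (b - 1) z u) u := by
  have hexp : HasDerivAt (fun v : ℂ => Complex.exp (-v)) (Complex.exp (-(u : ℂ)) * -1) (u : ℂ) :=
    (hasDerivAt_neg (u : ℂ)).cexp
  have hpow : HasDerivAt (fun v : ℂ => v ^ (q + 1)) ((q + 1) * (u : ℂ) ^ (q + 1 - 1) * 1) (u : ℂ) :=
    (hasDerivAt_id (u : ℂ)).cpow_const (Complex.ofReal_mem_slitPlane.2 hu)
  have hbase : HasDerivAt (fun v : ℂ => (1 + v / (2 * z)) ^ b)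
      (b * (1 + (u : ℂ) / (2 * z)) ^ (b - 1) * (1 / (2 * z))) (u : ℂ) :=
    (((hasDerivAt_id (u : ℂ)).div_const (2 * z)).const_add 1).cpow_const
      (one_add_div_mem_slitPlane hz hu)
  refine (((hexp.mul hpow).mul hbase).comp_ofReal.congr_deriv ?_).congr_of_eventuallyEq
    (Eventually.of_forall fun v => ?_)
  · simp only [laplaceIntegrand, Pi.mul_apply, Complex.ofReal_exp, Complex.ofReal_neg,
      add_sub_cancel_right]
    ring
  · simp [laplaceIntegrand]

lemma laplaceInt_integral_by_parts {q b z : ℂ} (hq : -1 < q.re) (hb : b.re ≤ 0)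
    (hz : z ∈ Complex.slitPlane) :
    laplaceInt (q + 1) b z =
      (q + 1) * laplaceInt q b z + b / (2 * z) * laplaceInt (q + 1) (b - 1) z := by
  have hb1 : (b - 1).re ≤ 0 := re_sub_one_nonpos hb
  have hq1 : -1 < (q + 1).re := neg_one_lt_re_add_one hq
  have hi := integrableOn_laplaceIntegrand hq1 hb hz
  have hi₀ := (integrableOn_laplaceIntegrand hq hb hz).const_mul (q + 1)
  have hi₁ := (integrableOn_laplaceIntegrand hq1 hb1 hz).const_mul (b / (2 * z))
  have hsum : IntegrableOn (fun u => -laplaceIntegrand (q + 1) b z u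
      + (q + 1) * laplaceIntegrand q b z u) (Ioi 0) := hi.neg.add hi₀
  have hq0 : 0 < (q + 1).re := by rw [Complex.add_re, Complex.one_re]; linarith
  have hcont : ContinuousWithinAt (laplaceIntegrand (q + 1) b z) (Ici 0) 0 := by
    refine ContinuousAt.continuousWithinAt ((ContinuousAt.mul (by fun_prop)
      (Complex.continuousAt_ofReal_cpow_const 0 (q + 1) (Or.inl hq0))).mul ?_)
    exact ContinuousAt.cpow (by fun_prop) continuousAt_const (by simp)
  have hderiv := fun u (hu : u ∈ Ioi (0 : ℝ)) => hasDerivAt_laplaceIntegrand_right q b hz hu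
  have hparts := integral_Ioi_of_hasDerivAt_of_tendsto hcont hderiv (hsum.add hi₁)
    (tendsto_zero_of_hasDerivAt_of_integrableOn_Ioi hderiv (hsum.add hi₁) hi)
  have hzero : laplaceIntegrand (q + 1) b z 0 = 0 := by
    have : q + 1 ≠ 0 := fun h => by simp [h] at hq0
    simp [laplaceIntegrand, Complex.zero_cpow this]
  rw [integral_add hsum hi₁, integral_add (f := fun u => -laplaceIntegrand (q + 1) b z u) hi.neg
    hi₀, integral_neg, integral_const_mul, integral_const_mul, hzero, sub_zero] at hparts
  simp only [laplaceInt]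
  linear_combination -hparts

/-- The derivative of `laplaceInt q q`. -/
def laplaceDeriv (q z : ℂ) : ℂ := -(q / (2 * z ^ 2)) * laplaceInt (q + 1) (q - 1) z

/-- The second derivative of `laplaceInt q q`. -/
def laplaceDerivTwo (q z : ℂ) : ℂ :=
  2 * laplaceDeriv q z + q * (q + 1) / z ^ 2 * laplaceInt q q z

section LaplaceODE

variable {q z : ℂ} (hq : -1 < q.re) (hq0 : q.re ≤ 0)
include hq hq0

lemma hasDerivAt_laplaceInt_self (hz : z ∈ Complex.slitPlane) :
    HasDerivAt (laplaceInt q q) (laplaceDeriv q z) z :=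
  hasDerivAt_laplaceInt hq hq0 hz

lemma hasDerivAt_laplaceDeriv (hz : z ∈ Complex.slitPlane) :
    HasDerivAt (laplaceDeriv q) (laplaceDerivTwo q z) z := by
  have hz0 : z ≠ 0 := Complex.slitPlane_ne_zero hz
  have hq1 : -1 < (q + 1).re := neg_one_lt_re_add_one hq
  have hb1 : (q - 1).re ≤ 0 := re_sub_one_nonpos hq0
  have hcoeff : HasDerivAt (fun w : ℂ => -(q / (2 * w ^ 2))) (q / z ^ 3) z := by
    refine (((hasDerivAt_pow 2 z).const_mul 2).inv (by simpa)).const_mul (-q) |>.congr_deriv ?_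
      |>.congr_of_eventuallyEq (Eventually.of_forall fun w => ?_)
    · push_cast; field_simp
    · simp [div_eq_mul_inv]
  refine (hcoeff.mul (hasDerivAt_laplaceInt hq1 hb1 hz)).congr_deriv ?_
  have hA := laplaceInt_succ hq hq0 hz
  have hB := laplaceInt_succ hq hb1 hz
  have hC := laplaceInt_succ hq1 hb1 hz
  have hparts := laplaceInt_integral_by_parts hq hb1 hz
  rw [hB] at hC hparts
  rw [hA] at hC hparts
  rw [laplaceDerivTwo, laplaceDeriv, hC, hA]
  field_simp at hparts ⊢
  linear_combination q * hparts

lemma norm_mul_laplaceDeriv_le {c : ℝ} (hc : 0 < c) (hz : z ∈ Complex.slitPlane)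
    (hray : RayBound c z) :
    ‖z * laplaceDeriv q z‖ ≤ ‖q‖ * (laplaceBound q q c + laplaceBound q (q - 1) c) := by
  have hz0 : z ≠ 0 := Complex.slitPlane_ne_zero hz
  have hb1 : (q - 1).re ≤ 0 := re_sub_one_nonpos hq0
  have hform : z * laplaceDeriv q z = -q * (laplaceInt q q z - laplaceInt q (q - 1) z) := by
    rw [laplaceDeriv, laplaceInt_succ hq hq0 hz]; field_simp
  rw [hform, norm_mul, norm_neg]
  gcongr
  exact (norm_sub_le _ _).trans
    (add_le_add (norm_laplaceInt_le hc hq hq0 hray) (norm_laplaceInt_le hc hq hb1 hray))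

lemma norm_sq_mul_laplaceDerivTwo_le {c : ℝ} (hc : 0 < c) (hz0 : z ≠ 0) (hray : RayBound c z) :
    ‖z ^ 2 * laplaceDerivTwo q z‖ ≤
      ‖q‖ * (laplaceBound (q + 1) (q - 1) c + ‖q + 1‖ * laplaceBound q q c) := by
  have hform : z ^ 2 * laplaceDerivTwo q z =
      q * (-laplaceInt (q + 1) (q - 1) z + (q + 1) * laplaceInt q q z) := by
    rw [laplaceDerivTwo, laplaceDeriv]; field_simp
  rw [hform, norm_mul]
  gcongr
  refine (norm_add_le _ _).trans ?_
  rw [norm_neg, norm_mul]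
  gcongr
  · exact norm_laplaceInt_le hc (neg_one_lt_re_add_one hq) (re_sub_one_nonpos hq0) hray
  · exact norm_laplaceInt_le hc hq hq0 hray

lemma exists_laplace_bound {c : ℝ} (hc : 0 < c) :
    ∃ M : ℝ, 0 ≤ M ∧ ∀ z ∈ Complex.slitPlane, RayBound c z → ‖laplaceInt q q z‖ ≤ M ∧
      ‖z * laplaceDeriv q z‖ ≤ M ∧ ‖z ^ 2 * laplaceDerivTwo q z‖ ≤ M :=
  ⟨max (laplaceBound q q c) (max _ _), le_max_of_le_left (laplaceBound_nonneg q q hc),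
    fun _ hz hray => ⟨le_max_of_le_left (norm_laplaceInt_le hc hq hq0 hray),
      le_max_of_le_right (le_max_of_le_left (norm_mul_laplaceDeriv_le hq hq0 hc hz hray)),
      le_max_of_le_right (le_max_of_le_right (norm_sq_mul_laplaceDerivTwo_le hq hq0 hc
        (Complex.slitPlane_ne_zero hz) hray))⟩⟩

lemma continuousAt_laplaceDerivTwo (hz : z ∈ Complex.slitPlane) :
    ContinuousAt (laplaceDerivTwo q) z := by
  have hz0 : z ^ 2 ≠ 0 := pow_ne_zero 2 (Complex.slitPlane_ne_zero hz)
  have hcoeff : ContinuousAt (fun w : ℂ => q * (q + 1) / w ^ 2) z :=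
    continuousAt_const.div (by fun_prop) hz0
  exact ((hasDerivAt_laplaceDeriv hq hq0 hz).continuousAt.const_mul 2).add
    (hcoeff.mul (hasDerivAt_laplaceInt_self hq hq0 hz).continuousAt)

end LaplaceODE

section LaplaceLimits

variable {ι : Type*} {l : Filter ι} [l.IsCountablyGenerated] {c : ℝ} {q b : ℂ} {ζ : ι → ℂ}

lemma tendsto_laplaceInt_of_tendsto_laplaceIntegrand (hc : 0 < c) (hq : -1 < q.re) (hb : b.re ≤ 0)
    (hζ : ∀ᶠ i in l, ζ i ∈ Complex.slitPlane) (hray : ∀ᶠ i in l, RayBound c (ζ i)) {F : ℝ → ℂ}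
    (h : ∀ u : ℝ, 0 < u → Tendsto (fun i => laplaceIntegrand q b (ζ i) u) l (𝓝 (F u))) :
    Tendsto (fun i => laplaceInt q b (ζ i)) l (𝓝 (∫ u in Ioi (0 : ℝ), F u)) := by
  refine tendsto_integral_filter_of_dominated_convergence (laplaceMajorant q b c) ?_ ?_
    (integrableOn_laplaceMajorant hq b c) ?_
  · filter_upwards [hζ] with i hi
    exact aestronglyMeasurable_laplaceIntegrand q b hi
  · filter_upwards [hray] with i hi
    filter_upwards [ae_restrict_mem measurableSet_Ioi] with u hu
    exact norm_laplaceIntegrand_le hc q hi hb hu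
  · filter_upwards [ae_restrict_mem measurableSet_Ioi] with u hu using h u hu

lemma tendsto_laplaceInt_Gamma (hc : 0 < c) (hq : -1 < q.re) (hb : b.re ≤ 0)
    (hζ : ∀ᶠ i in l, ζ i ∈ Complex.slitPlane) (hray : ∀ᶠ i in l, RayBound c (ζ i))
    (h : Tendsto (fun i => (ζ i)⁻¹) l (𝓝 0)) :
    Tendsto (fun i => laplaceInt q b (ζ i)) l (𝓝 (Complex.Gamma (q + 1))) := by
  rw [Gamma_add_one_eq_integral hq]
  refine tendsto_laplaceInt_of_tendsto_laplaceIntegrand hc hq hb hζ hray fun u _ => ?_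
  have hbase : Tendsto (fun i => 1 + (u : ℂ) / (2 * ζ i)) l (𝓝 1) := by
    refine ((h.const_mul ((u : ℂ) / 2)).const_add 1).congr (fun i => ?_) |>.trans (by simp)
    ring
  have hpow := ((continuousAt_cpow_const (b := b) (by simp)).tendsto.comp hbase).const_mul
    ((Real.exp (-u) : ℂ) * (u : ℂ) ^ q)
  rwa [Complex.one_cpow, mul_one] at hpow

lemma tendsto_laplaceDeriv_zero (hc : 0 < c) (hq : -1 < q.re) (hq0 : q.re ≤ 0)
    (hζ : ∀ᶠ i in l, ζ i ∈ Complex.slitPlane) (hray : ∀ᶠ i in l, RayBound c (ζ i))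
    (h : Tendsto (fun i => (ζ i)⁻¹) l (𝓝 0)) :
    Tendsto (fun i => laplaceDeriv q (ζ i)) l (𝓝 0) := by
  have hlim := ((h.pow 2).const_mul (-(q / 2))).mul (tendsto_laplaceInt_Gamma hc
    (neg_one_lt_re_add_one hq) (re_sub_one_nonpos hq0) hζ hray h)
  rw [zero_pow two_ne_zero, mul_zero, zero_mul] at hlim
  refine hlim.congr fun i => ?_
  rw [laplaceDeriv, inv_pow]
  ring

omit [l.IsCountablyGenerated] in
lemma tendsto_norm_one_add_div_atTop {u : ℝ} (hu : 0 < u) (hζ : ∀ᶠ i in l, ζ i ≠ 0)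
    (h : Tendsto ζ l (𝓝 0)) : Tendsto (fun i => ‖1 + (u : ℂ) / (2 * ζ i)‖) l atTop := by
  have hinv : Tendsto (fun i => ‖(ζ i)⁻¹‖) l atTop :=
    (tendsto_norm_cobounded_atTop.comp tendsto_inv₀_nhdsNE_zero).comp
      (tendsto_nhdsWithin_iff.2 ⟨h, hζ⟩)
  refine tendsto_atTop_mono (fun i => ?_)
    (tendsto_atTop_add_const_right l (-1 : ℝ) (hinv.const_mul_atTop (half_pos hu)))
  have hnorm : ‖(u : ℂ) / (2 * ζ i)‖ = u / 2 * ‖(ζ i)⁻¹‖ := by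
    rw [norm_div, norm_mul, Complex.norm_real, Real.norm_of_nonneg hu.le, Complex.norm_ofNat,
      norm_inv]
    ring
  have := norm_sub_le (1 + (u : ℂ) / (2 * ζ i)) 1
  rw [add_sub_cancel_left, hnorm, norm_one] at this
  linarith

lemma tendsto_laplaceInt_zero (hc : 0 < c) (hq : -1 < q.re) (hb : b.re < 0)
    (hζ : ∀ᶠ i in l, ζ i ∈ Complex.slitPlane) (hray : ∀ᶠ i in l, RayBound c (ζ i))
    (h : Tendsto ζ l (𝓝 0)) :
    Tendsto (fun i => laplaceInt q b (ζ i)) l (𝓝 0) := by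
  rw [← integral_zero ℝ ℂ (μ := volume.restrict (Ioi 0))]
  refine tendsto_laplaceInt_of_tendsto_laplaceIntegrand hc hq hb.le hζ hray fun u hu => ?_
  have hdecay : Tendsto
      (fun i => ‖1 + (u : ℂ) / (2 * ζ i)‖ ^ b.re * Real.exp (Real.pi * |b.im|)) l (𝓝 0) := by
    have := (tendsto_rpow_neg_atTop (neg_pos.2 hb)).comp
      (tendsto_norm_one_add_div_atTop hu (hζ.mono fun _ => Complex.slitPlane_ne_zero) h)
    simpa using this.mul_const (Real.exp (Real.pi * |b.im|))
  have hpow : Tendsto (fun i => (1 + (u : ℂ) / (2 * ζ i)) ^ b) l (𝓝 0) := by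
    refine squeeze_zero_norm' ?_ hdecay
    filter_upwards [hζ] with i hi
    exact norm_cpow_le_of_le_norm (norm_pos_iff.2 (one_add_div_ne_zero hi hu)) le_rfl hb.le
  simpa only [mul_zero, laplaceIntegrand] using hpow.const_mul ((Real.exp (-u) : ℂ) * (u : ℂ) ^ q)

end LaplaceLimits

lemma rpow_le_rpow_add_one {u r s : ℝ} (hu : 0 < u) (hrs : r ≤ s) (hs : s ≤ 0) :
    u ^ s ≤ u ^ r + 1 := by
  rcases le_total u 1 with h | h
  · exact (Real.rpow_le_rpow_of_exponent_ge hu h hrs).trans (le_add_of_nonneg_right zero_le_one)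
  · exact (Real.rpow_le_one_of_one_le_of_nonpos h hs).trans
      (le_add_of_nonneg_left (by positivity))

lemma continuousAt_laplaceInt_order {q z : ℂ} (hq : -1 < q.re) (hq0 : q.re < 0)
    (hz : z ∈ Complex.slitPlane) : ContinuousAt (fun p => laplaceInt p p z) q := by
  obtain ⟨c, hc, hev⟩ := eventually_rayBound hz
  obtain ⟨r, hr, hrq⟩ := exists_between hq
  obtain ⟨C, hC⟩ : ∃ C : ℝ, ∀ᶠ p : ℂ in 𝓝 q, c ^ p.re * Real.exp (Real.pi * |p.im|) ≤ C := by
    have hcont : ContinuousAt (fun p : ℂ => c ^ p.re * Real.exp (Real.pi * |p.im|)) q :=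
      (continuousAt_const.rpow (by fun_prop) (Or.inl hc.ne')).mul (by fun_prop)
    exact ⟨_, hcont.eventually_le_const (lt_add_one _)⟩
  refine tendsto_integral_filter_of_dominated_convergence
    (fun u => (Real.exp (-u) * u ^ r + Real.exp (-u) * u ^ (0 : ℝ)) * C) ?_ ?_ ?_ ?_
  · exact Eventually.of_forall fun p => aestronglyMeasurable_laplaceIntegrand p p hz
  · filter_upwards [hC, Complex.continuous_re.continuousAt.eventually (lt_mem_nhds hrq),
      Complex.continuous_re.continuousAt.eventually (gt_mem_nhds hq0)] with p hpC hrp hp0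
    filter_upwards [ae_restrict_mem measurableSet_Ioi] with u (hu : 0 < u)
    refine (norm_laplaceIntegrand_le hc p hev.self_of_nhds hp0.le hu).trans ?_
    rw [laplaceMajorant, ← mul_add, Real.rpow_zero]
    gcongr
    exact rpow_le_rpow_add_one hu hrp.le hp0.le
  · exact ((integrableOn_exp_mul_rpow hr).add
      (integrableOn_exp_mul_rpow (by norm_num))).mul_const _
  · filter_upwards [ae_restrict_mem measurableSet_Ioi] with u (hu : 0 < u)
    have hu0 : (u : ℂ) ≠ 0 := Complex.ofReal_ne_zero.2 hu.ne'
    exact (continuousAt_const.mul (continuousAt_const_cpow hu0)).mul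
      (continuousAt_const_cpow (one_add_div_ne_zero hz hu))

/-! ### Power series solutions -/

section PowerSeries

variable {c : ℕ → ℂ} {C : ℝ}

lemma norm_mul_pow_div_factorial_le (hc : ∀ k, ‖c k‖ ≤ C) {x : ℂ} {R : ℝ} (hx : ‖x‖ ≤ R) (k : ℕ) :
    ‖c k * (x ^ k / k.factorial)‖ ≤ C * (R ^ k / k.factorial) := by
  have : 0 ≤ C := (norm_nonneg _).trans (hc k)
  rw [norm_mul, norm_div, norm_pow, Complex.norm_natCast]
  gcongr
  exact hc k

lemma summable_mul_pow_div_factorial (hc : ∀ k, ‖c k‖ ≤ C) (x : ℂ) :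
    Summable fun k : ℕ => c k * (x ^ k / k.factorial) :=
  Summable.of_norm_bounded ((Real.summable_pow_div_factorial ‖x‖).mul_left C)
    (norm_mul_pow_div_factorial_le hc le_rfl)

lemma deriv_pow_succ_div_factorial (k : ℕ) (x : ℂ) :
    deriv (fun y : ℂ => y ^ (k + 1) / (k + 1).factorial) x = x ^ k / k.factorial := by
  have : (k : ℂ) + 1 ≠ 0 := Nat.cast_add_one_ne_zero k
  rw [deriv_div_const, deriv_pow_field, Nat.factorial_succ, Nat.add_sub_cancel]
  push_cast
  exact mul_div_mul_left _ _ this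

lemma hasDerivAt_tsum_mul_pow_div_factorial (hc : ∀ k, ‖c k‖ ≤ C) (x : ℂ) :
    HasDerivAt (fun y : ℂ => ∑' k : ℕ, c k * (y ^ k / k.factorial))
      (∑' k : ℕ, c (k + 1) * (x ^ k / k.factorial)) x := by
  have hu := (Real.summable_pow_div_factorial (‖x‖ + 1)).mul_left C
  have hdiff : ∀ k : ℕ, DifferentiableOn ℂ (fun y : ℂ => c k * (y ^ k / k.factorial))
      (Metric.ball 0 (‖x‖ + 1)) := fun k => by fun_prop
  have hbound : ∀ (k : ℕ), ∀ y ∈ Metric.ball (0 : ℂ) (‖x‖ + 1),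
      ‖c k * (y ^ k / k.factorial)‖ ≤ C * ((‖x‖ + 1) ^ k / k.factorial) := fun k y hy =>
    norm_mul_pow_div_factorial_le hc (mem_ball_zero_iff.1 hy).le k
  have hx : x ∈ Metric.ball (0 : ℂ) (‖x‖ + 1) := mem_ball_zero_iff.2 (lt_add_one _)
  have hsum := Complex.hasSum_deriv_of_summable_norm hu hdiff Metric.isOpen_ball hbound hx
  refine ((Complex.differentiableOn_tsum_of_summable_norm hu hdiff Metric.isOpen_ball
    hbound).differentiableAt (Metric.isOpen_ball.mem_nhds hx)).hasDerivAt.congr_deriv ?_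
  rw [← hsum.tsum_eq, hsum.summable.tsum_eq_zero_add]
  simp only [deriv_const_mul_field', deriv_pow_succ_div_factorial]
  simp

lemma hasSum_mul_natCast_mul_pow_div_factorial {x a : ℂ}
    (h : HasSum (fun k : ℕ => c (k + 1) * (x ^ k / k.factorial)) a) :
    HasSum (fun k : ℕ => c k * (k * (x ^ k / k.factorial))) (x * a) := by
  rw [← hasSum_nat_add_iff' 1]
  simp only [Finset.range_one, Finset.sum_singleton, Nat.cast_zero, zero_mul, mul_zero, sub_zero]
  refine (h.mul_left x).congr_fun fun k => ?_
  have h1 : (k.factorial : ℂ) ≠ 0 := Nat.cast_ne_zero.2 k.factorial_ne_zero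
  have h2 : (k : ℂ) + 1 ≠ 0 := Nat.cast_add_one_ne_zero k
  rw [Nat.factorial_succ, pow_succ]
  push_cast
  field_simp

end PowerSeries

lemma norm_inv_Gamma_add_one_le {s : ℂ} (hs : 1 ≤ ‖s‖) :
    ‖(Complex.Gamma (s + 1))⁻¹‖ ≤ ‖(Complex.Gamma s)⁻¹‖ := by
  rw [Complex.one_div_Gamma_eq_self_mul_one_div_Gamma_add_one s, norm_mul]
  exact le_mul_of_one_le_left (norm_nonneg _) hs

lemma one_le_norm_add_natCast_add_one {μ : ℂ} {k : ℕ} (h : ‖μ‖ ≤ k) : 1 ≤ ‖μ + k + 1‖ := by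
  have hsub := norm_sub_le (μ + k + 1) μ
  rw [show μ + k + 1 - μ = ((k + 1 : ℕ) : ℂ) by push_cast; ring, Complex.norm_natCast] at hsub
  push_cast at hsub
  linarith

lemma norm_inv_Gamma_le_sum {μ : ℂ} {N : ℕ} (hμ : ‖μ‖ ≤ N) (k : ℕ) :
    ‖(Complex.Gamma (μ + k + 1))⁻¹‖ ≤
      ∑ i ∈ Finset.range (N + 1), ‖(Complex.Gamma (μ + i + 1))⁻¹‖ := by
  have hle : ∀ i ≤ N, ‖(Complex.Gamma (μ + i + 1))⁻¹‖ ≤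
      ∑ i ∈ Finset.range (N + 1), ‖(Complex.Gamma (μ + i + 1))⁻¹‖ := fun i hi =>
    Finset.single_le_sum (f := fun i : ℕ => ‖(Complex.Gamma (μ + i + 1))⁻¹‖)
      (fun _ _ => norm_nonneg _) (Finset.mem_range.2 (Nat.lt_succ_of_le hi))
  rcases le_total k N with hk | hk
  · exact hle k hk
  induction k, hk using Nat.le_induction with
  | base => exact hle N le_rfl
  | succ k hk ih =>
    rw [Nat.cast_succ, ← add_assoc μ]
    exact (norm_inv_Gamma_add_one_le (one_le_norm_add_natCast_add_one
      (hμ.trans (Nat.cast_le.2 hk)))).trans ih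

lemma continuous_inv_Gamma_add_natCast (k : ℕ) :
    Continuous fun μ : ℂ => (Complex.Gamma (μ + k + 1))⁻¹ :=
  Complex.differentiable_one_div_Gamma.continuous.comp (by fun_prop)

lemma eventually_norm_inv_Gamma_le (ν : ℂ) :
    ∃ C : ℝ, ∀ᶠ μ in 𝓝 ν, ∀ k : ℕ, ‖(Complex.Gamma (μ + k + 1))⁻¹‖ ≤ C := by
  obtain ⟨N, hN⟩ := exists_nat_gt ‖ν‖
  have hcont : Continuous fun μ : ℂ =>
      ∑ i ∈ Finset.range (N + 1), ‖(Complex.Gamma (μ + i + 1))⁻¹‖ :=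
    continuous_finsetSum _ fun i _ => (continuous_inv_Gamma_add_natCast i).norm
  refine ⟨∑ i ∈ Finset.range (N + 1), ‖(Complex.Gamma (ν + i + 1))⁻¹‖ + 1, ?_⟩
  filter_upwards [hcont.continuousAt.eventually_le_const (lt_add_one _),
    continuous_norm.continuousAt.eventually (gt_mem_nhds hN)] with μ hsum hμ k
  exact (norm_inv_Gamma_le_sum hμ.le k).trans hsum

/-- The entire function `S_ν(x) = ∑ₖ xᵏ / (k! Γ(ν + k + 1))`; one has
`J_ν(w) = (w/2)^ν S_ν(-w²/4)` and `I_ν(w) = (w/2)^ν S_ν(w²/4)`. -/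
def besselSeries (ν x : ℂ) : ℂ :=
  ∑' k : ℕ, (Complex.Gamma (ν + k + 1))⁻¹ * (x ^ k / k.factorial)

lemma hasSum_besselSeries (ν x : ℂ) :
    HasSum (fun k : ℕ => (Complex.Gamma (ν + k + 1))⁻¹ * (x ^ k / k.factorial))
      (besselSeries ν x) :=
  let ⟨_, hC⟩ := eventually_norm_inv_Gamma_le ν
  (summable_mul_pow_div_factorial hC.self_of_nhds x).hasSum

lemma hasDerivAt_besselSeries (ν x : ℂ) :
    HasDerivAt (besselSeries ν) (besselSeries (ν + 1) x) x := by
  obtain ⟨C, hC⟩ := eventually_norm_inv_Gamma_le ν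
  refine (hasDerivAt_tsum_mul_pow_div_factorial hC.self_of_nhds x).congr_deriv ?_
  refine tsum_congr fun k => ?_
  rw [show ν + ((k + 1 : ℕ) : ℂ) + 1 = ν + 1 + k + 1 by push_cast; ring]

lemma besselSeries_zero (ν : ℂ) : besselSeries ν 0 = (Complex.Gamma (ν + 1))⁻¹ := by
  rw [besselSeries, tsum_eq_single 0 fun k hk => by simp [hk]]
  simp

lemma besselSeries_recurrence (ν x : ℂ) :
    x * besselSeries (ν + 2) x + (ν + 1) * besselSeries (ν + 1) x = besselSeries ν x := by
  have hshift : HasSum (fun k : ℕ => (Complex.Gamma (ν + 1 + k + 1))⁻¹ *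
      (k * (x ^ k / k.factorial))) (x * besselSeries (ν + 2) x) := by
    refine hasSum_mul_natCast_mul_pow_div_factorial
      (c := fun k : ℕ => (Complex.Gamma (ν + 1 + k + 1))⁻¹)
      ((hasSum_besselSeries (ν + 2) x).congr_fun fun k => ?_)
    rw [show ν + 1 + ((k + 1 : ℕ) : ℂ) + 1 = ν + 2 + k + 1 by push_cast; ring]
  refine ((hshift.add ((hasSum_besselSeries (ν + 1) x).mul_left (ν + 1))).congr_fun
    fun k => ?_).unique (hasSum_besselSeries ν x)
  rw [Complex.one_div_Gamma_eq_self_mul_one_div_Gamma_add_one (ν + k + 1),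
    show ν + k + 1 + 1 = ν + 1 + k + 1 by ring]
  ring

lemma continuous_besselSeries_order (x : ℂ) : Continuous fun ν => besselSeries ν x := by
  refine continuous_iff_continuousAt.2 fun ν => ?_
  obtain ⟨C, hC⟩ := eventually_norm_inv_Gamma_le ν
  obtain ⟨s, hs, hsub⟩ := hC.exists_mem
  exact (continuousOn_tsum
    (fun k => ((continuous_inv_Gamma_add_natCast k).mul continuous_const).continuousOn)
    ((Real.summable_pow_div_factorial ‖x‖).mul_left C)
    fun k μ hμ => norm_mul_pow_div_factorial_le (hsub μ hμ) le_rfl k).continuousAt hs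

lemma besselJ_eq (ν w : ℂ) : besselJ ν w = (w / 2) ^ ν * besselSeries ν (-(w / 2) ^ 2) := by
  rw [besselJ, besselSeries]
  congr 1
  refine tsum_congr fun k => ?_
  rw [neg_pow ((w / 2) ^ 2), ← pow_mul, div_eq_mul_inv, mul_inv]
  ring

lemma Gamma_nat_add_half_div_factorial (k : ℕ) :
    Complex.Gamma (k + 1 / 2) / ((2 * k).factorial : ℂ) =
      (Real.sqrt Real.pi : ℂ) / (4 ^ k * (k.factorial : ℂ)) := by
  have h := Complex.Gamma_mul_Gamma_add_half ((k : ℂ) + 1 / 2)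
  rw [show (k : ℂ) + 1 / 2 + 1 / 2 = k + 1 by ring, Complex.Gamma_nat_eq_factorial,
    show 2 * ((k : ℂ) + 1 / 2) = ((2 * k : ℕ) : ℂ) + 1 by push_cast; ring,
    Complex.Gamma_nat_eq_factorial,
    show (1 : ℂ) - (((2 * k : ℕ) : ℂ) + 1) = -((2 * k : ℕ) : ℂ) by ring, Complex.cpow_neg,
    Complex.cpow_natCast, pow_mul, show (2 : ℂ) ^ 2 = 4 by norm_num] at h
  have h1 : (k.factorial : ℂ) ≠ 0 := Nat.cast_ne_zero.2 k.factorial_ne_zero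
  have h2 : ((2 * k).factorial : ℂ) ≠ 0 := Nat.cast_ne_zero.2 (2 * k).factorial_ne_zero
  field_simp at h ⊢
  linear_combination h

lemma sq_cpow_mul_self {s : ℝ} (hs : 0 < s) (k : ℕ) :
    ((s ^ 2 : ℝ) : ℂ) ^ ((k : ℂ) + 1 / 2 - 1) * s = (s : ℂ) ^ (2 * k) := by
  rw [show (k : ℂ) + 1 / 2 - 1 = ((k - 1 / 2 : ℝ) : ℂ) by push_cast; ring,
    ← Complex.ofReal_cpow (by positivity), ← Complex.ofReal_mul, ← Complex.ofReal_pow,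
    ← Real.rpow_natCast, ← Real.rpow_mul hs.le, ← Real.rpow_add_one hs.ne', ← Real.rpow_natCast]
  congr 2
  push_cast
  ring

lemma integral_pow_mul_one_sub_sq_cpow (k : ℕ) (q : ℂ) :
    ∫ s in (0 : ℝ)..1, 2 * (s : ℂ) ^ (2 * k) * (1 - (s : ℂ) ^ 2) ^ q =
      Complex.betaIntegral (k + 1 / 2) (q + 1) := by
  symm
  rw [Complex.betaIntegral, intervalIntegral.integral_of_le zero_le_one,
    intervalIntegral.integral_of_le zero_le_one, ← Ioi_inter_Iic,
    ← setIntegral_indicator measurableSet_Iic, ← setIntegral_indicator measurableSet_Iic,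
    ← integral_comp_rpow_Ioi_of_pos (two_pos : (0 : ℝ) < 2)]
  refine setIntegral_congr_fun measurableSet_Ioi fun s (hs : 0 < s) => ?_
  have hs1 : s ^ ((2 : ℝ) - 1) = s := by norm_num
  simp only [Real.rpow_two, hs1, indicator_apply, mem_Iic, sq_le_one_iff₀ hs.le]
  split_ifs
  · rw [add_sub_cancel_right, Complex.real_smul, ← sq_cpow_mul_self hs k]
    push_cast
    ring
  · simp

lemma intervalIntegrable_one_sub_sq_cpow {q : ℂ} (hq : -1 < q.re) :
    IntervalIntegrable (fun s : ℝ => (1 - (s : ℂ) ^ 2) ^ q) volume 0 1 := by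
  have hsing : IntervalIntegrable (fun s : ℝ => ((1 - s : ℝ) : ℂ) ^ q) volume 0 1 := by
    simpa using ((intervalIntegral.intervalIntegrable_cpow' hq).comp_sub_left (a := 0) (b := 1)
      1).symm
  have hcont : ContinuousOn (fun s : ℝ => ((1 + s : ℝ) : ℂ) ^ q) (uIcc 0 1) := by
    intro s hs
    rw [uIcc_of_le zero_le_one] at hs
    have hmem : ((1 + s : ℝ) : ℂ) ∈ Complex.slitPlane :=
      Complex.ofReal_mem_slitPlane.2 (by linarith [hs.1])
    exact ((continuousAt_cpow_const hmem).comp_of_eq (f := fun s : ℝ => ((1 + s : ℝ) : ℂ))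
      (by fun_prop) rfl).continuousWithinAt
  refine (hsing.mul_continuousOn hcont).congr fun s hs => ?_
  rw [uIoc_of_le zero_le_one] at hs
  rw [← Complex.mul_cpow_ofReal_nonneg (by linarith [hs.2]) (by linarith [hs.1])]
  congr 1
  push_cast
  ring

section Poisson

variable {q : ℂ} (hq : -1 < q.re)
include hq

lemma integral_cosh_term_mul_one_sub_sq_cpow (τ : ℂ) (k : ℕ) :
    ∫ s in (0 : ℝ)..1, 2 * ((τ * s) ^ (2 * k) / ((2 * k).factorial : ℂ)) *
        (1 - (s : ℂ) ^ 2) ^ q =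
      (Real.sqrt Real.pi : ℂ) * Complex.Gamma (q + 1) *
        ((Complex.Gamma (q + 1 / 2 + k + 1))⁻¹ * (((τ / 2) ^ 2) ^ k / k.factorial)) := by
  have hre : 0 < (q + 1 / 2 + k + 1).re := by
    have : (0 : ℝ) ≤ k := Nat.cast_nonneg k
    simp only [Complex.add_re, Complex.natCast_re, Complex.one_re, Complex.div_ofNat_re]
    linarith
  have hre₁ : 0 < ((k : ℂ) + 1 / 2).re := by
    rw [Complex.add_re, Complex.natCast_re, Complex.div_ofNat_re, Complex.one_re]
    positivity
  have hre₂ : 0 < (q + 1).re := by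
    rw [Complex.add_re, Complex.one_re]
    linarith
  have hbeta : Complex.betaIntegral (k + 1 / 2) (q + 1) = Complex.Gamma (k + 1 / 2) *
      Complex.Gamma (q + 1) * (Complex.Gamma (q + 1 / 2 + k + 1))⁻¹ := by
    rw [Complex.Gamma_mul_Gamma_eq_betaIntegral hre₁ hre₂,
      show (k : ℂ) + 1 / 2 + (q + 1) = q + 1 / 2 + k + 1 by ring, mul_comm,
      inv_mul_cancel_left₀ (Complex.Gamma_ne_zero_of_re_pos hre)]
  calc _ = τ ^ (2 * k) / ((2 * k).factorial : ℂ) *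
        ∫ s in (0 : ℝ)..1, 2 * (s : ℂ) ^ (2 * k) * (1 - (s : ℂ) ^ 2) ^ q := by
        rw [← intervalIntegral.integral_const_mul]
        congr 1 with s
        rw [mul_pow]
        ring
    _ = τ ^ (2 * k) * (Complex.Gamma (k + 1 / 2) / ((2 * k).factorial : ℂ)) *
        (Complex.Gamma (q + 1) * (Complex.Gamma (q + 1 / 2 + k + 1))⁻¹) := by
        rw [integral_pow_mul_one_sub_sq_cpow, hbeta]
        ring
    _ = _ := by
        rw [Gamma_nat_add_half_div_factorial, ← pow_mul, div_pow, pow_mul (2 : ℂ),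
          show (2 : ℂ) ^ 2 = 4 by norm_num]
        ring

/-- Poisson's integral for the modified Bessel function of the first kind. -/
lemma besselSeries_eq_integral (τ : ℂ) :
    (Real.sqrt Real.pi : ℂ) * Complex.Gamma (q + 1) * besselSeries (q + 1 / 2) ((τ / 2) ^ 2) =
      ∫ s in (0 : ℝ)..1, 2 * Complex.cosh (τ * s) * (1 - (s : ℂ) ^ 2) ^ q := by
  have hw := intervalIntegrable_one_sub_sq_cpow hq
  refine ((hasSum_besselSeries (q + 1 / 2) ((τ / 2) ^ 2)).mul_left
    ((Real.sqrt Real.pi : ℂ) * Complex.Gamma (q + 1))).unique ?_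
  simp_rw [← integral_cosh_term_mul_one_sub_sq_cpow hq τ]
  refine intervalIntegral.hasSum_integral_of_dominated_convergence
    (fun k s => 2 * (‖τ‖ ^ (2 * k) / ((2 * k).factorial : ℝ)) * ‖(1 - (s : ℂ) ^ 2) ^ q‖)
    (fun k => ?_) (fun k => ?_) ?_ ?_ ?_
  · exact (Continuous.aestronglyMeasurable (by fun_prop)).mul
      hw.aestronglyMeasurable_restrict_uIoc
  · filter_upwards with s hs
    rw [uIoc_of_le zero_le_one] at hs
    have hs1 : ‖(s : ℂ)‖ ≤ 1 := by
      rw [Complex.norm_real, Real.norm_of_nonneg hs.1.le]; exact hs.2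
    rw [norm_mul, norm_mul, norm_div, norm_pow, norm_mul, Complex.norm_natCast,
      Complex.norm_ofNat]
    gcongr
    exact mul_le_of_le_one_right (norm_nonneg _) hs1
  · filter_upwards with s _
    exact ((Real.hasSum_cosh ‖τ‖).summable.mul_left 2).mul_right _
  · simp_rw [tsum_mul_right]
    exact hw.norm.const_mul _
  · filter_upwards with s _
    exact ((Complex.hasSum_cosh _).mul_left 2).mul_right _

end Poisson

/-- The integrand of `τ^(q+1) e^{-τ}` times Poisson's integral in the variable `u = τ (1 - s)`. -/
def poissonIntegrand (q : ℂ) (τ u : ℝ) : ℂ :=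
  (Iic τ).indicator (fun u => ((Real.exp (-u) + Real.exp (u - 2 * τ) : ℝ) : ℂ) * (u : ℂ) ^ q *
    ((2 - u / τ : ℝ) : ℂ) ^ q) u

lemma norm_poissonIntegrand_le (q : ℂ) {τ u : ℝ} (hu : 0 < u) :
    ‖poissonIntegrand q τ u‖ ≤ Real.exp (-u) * u ^ q.re * (2 * 2 ^ |q.re|) := by
  simp only [poissonIntegrand, indicator_apply, mem_Iic]
  split_ifs with h
  · have hτ : 0 < τ := hu.trans_le h
    have hle : u / τ ≤ 1 := (div_le_one hτ).2 h
    have hge : 0 ≤ u / τ := by positivity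
    have hpos : 0 < 2 - u / τ := by linarith
    rw [norm_mul, norm_mul, Complex.norm_cpow_eq_rpow_re_of_pos hu,
      Complex.norm_cpow_eq_rpow_re_of_pos hpos, Complex.norm_real,
      Real.norm_of_nonneg (by positivity)]
    have hexp : Real.exp (-u) + Real.exp (u - 2 * τ) ≤ 2 * Real.exp (-u) := by
      have : Real.exp (u - 2 * τ) ≤ Real.exp (-u) := Real.exp_le_exp.2 (by linarith)
      linarith
    have hpow : (2 - u / τ) ^ q.re ≤ 2 ^ |q.re| :=
      (Real.rpow_le_rpow_of_exponent_le (by linarith) (le_abs_self _)).trans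
        (Real.rpow_le_rpow hpos.le (by linarith) (abs_nonneg _))
    calc (Real.exp (-u) + Real.exp (u - 2 * τ)) * u ^ q.re * (2 - u / τ) ^ q.re
        ≤ 2 * Real.exp (-u) * u ^ q.re * 2 ^ |q.re| := by gcongr
      _ = _ := by ring
  · rw [norm_zero]; positivity

lemma tendsto_poissonIntegrand (q : ℂ) (u : ℝ) :
    Tendsto (fun τ => poissonIntegrand q τ u) atTop
      (𝓝 ((Real.exp (-u) : ℂ) * (u : ℂ) ^ q * 2 ^ q)) := by
  have hexp : Tendsto (fun τ : ℝ => ((Real.exp (-u) + Real.exp (u - 2 * τ) : ℝ) : ℂ)) atTop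
      (𝓝 (Real.exp (-u) : ℂ)) := by
    refine (Complex.continuous_ofReal.tendsto _).comp ?_
    have : Tendsto (fun τ : ℝ => u - 2 * τ) atTop atBot :=
      tendsto_atBot_add_const_left _ u
        (tendsto_neg_atTop_atBot.comp (tendsto_id.const_mul_atTop two_pos))
    simpa using (Real.tendsto_exp_atBot.comp this).const_add (Real.exp (-u))
  have hpow : Tendsto (fun τ : ℝ => ((2 - u / τ : ℝ) : ℂ) ^ q) atTop (𝓝 (((2 : ℝ) : ℂ) ^ q)) := by
    refine (continuousAt_cpow_const (Complex.ofReal_mem_slitPlane.2 two_pos)).tendsto.comp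
      ((Complex.continuous_ofReal.tendsto _).comp ?_)
    simpa using (tendsto_id.const_div_atTop u).const_sub (2 : ℝ)
  refine ((hexp.mul_const _).mul hpow).congr' ?_
  filter_upwards [eventually_ge_atTop u] with τ hτ
  rw [poissonIntegrand, indicator_of_mem (mem_Iic.2 hτ)]

lemma poissonIntegrand_eq (q : ℂ) {τ u : ℝ} (hu : 0 < u) (huτ : u ≤ τ) :
    poissonIntegrand q τ u = (τ : ℂ) ^ q * (Real.exp (-τ) : ℂ) *
      (2 * Complex.cosh (τ * (1 - u / τ : ℝ)) * (1 - ((1 - u / τ : ℝ) : ℂ) ^ 2) ^ q) := by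
  have hτ : 0 < τ := hu.trans_le huτ
  have hτ0 : (τ : ℂ) ≠ 0 := Complex.ofReal_ne_zero.2 hτ.ne'
  have hle : u / τ ≤ 1 := (div_le_one hτ).2 huτ
  have hfactor : (1 - ((1 - u / τ : ℝ) : ℂ) ^ 2) ^ q =
      ((u / τ : ℝ) : ℂ) ^ q * ((2 - u / τ : ℝ) : ℂ) ^ q := by
    rw [← Complex.mul_cpow_ofReal_nonneg (by positivity) (by linarith)]
    congr 1
    push_cast
    ring
  have hscale : (u : ℂ) ^ q = (τ : ℂ) ^ q * ((u / τ : ℝ) : ℂ) ^ q := by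
    rw [← Complex.mul_cpow_ofReal_nonneg hτ.le (by positivity), ← Complex.ofReal_mul,
      mul_div_cancel₀ _ hτ.ne']
  have hexp : ((Real.exp (-u) + Real.exp (u - 2 * τ) : ℝ) : ℂ) =
      (Real.exp (-τ) : ℂ) * (2 * Complex.cosh (τ * (1 - u / τ : ℝ))) := by
    rw [Complex.two_cosh, mul_add]
    push_cast
    rw [← Complex.exp_add, ← Complex.exp_add, mul_sub, mul_one, mul_div_cancel₀ _ hτ0]
    ring_nf
  rw [poissonIntegrand, indicator_of_mem (mem_Iic.2 huτ), hfactor, hscale, hexp]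
  ring

lemma integral_poissonIntegrand {q : ℂ} (hq : -1 < q.re) {τ : ℝ} (hτ : 0 < τ) :
    ∫ u in Ioi (0 : ℝ), poissonIntegrand q τ u =
      (Real.sqrt Real.pi : ℂ) * Complex.Gamma (q + 1) * ((τ : ℂ) ^ (q + 1) * (Real.exp (-τ) : ℂ) *
        besselSeries (q + 1 / 2) ((τ / 2) ^ 2)) := by
  have hsubst := intervalIntegral.integral_comp_sub_div (a := 0) (b := τ)
    (fun s : ℝ => 2 * Complex.cosh (τ * s) * (1 - (s : ℂ) ^ 2) ^ q) hτ.ne' 1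
  rw [zero_div, div_self hτ.ne', sub_self, sub_zero, ← besselSeries_eq_integral hq,
    Complex.real_smul] at hsubst
  calc ∫ u in Ioi (0 : ℝ), poissonIntegrand q τ u
      = ∫ u in (0 : ℝ)..τ, (τ : ℂ) ^ q * (Real.exp (-τ) : ℂ) *
        (2 * Complex.cosh (τ * (1 - u / τ : ℝ)) * (1 - ((1 - u / τ : ℝ) : ℂ) ^ 2) ^ q) := by
        rw [intervalIntegral.integral_of_le hτ.le]
        refine setIntegral_eq_of_subset_of_forall_sdiff_eq_zero measurableSet_Ioi
          Ioc_subset_Ioi_self (fun u hu => ?_) |>.trans (setIntegral_congr_fun measurableSet_Ioc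
            fun u hu => poissonIntegrand_eq q hu.1 hu.2)
        have : u ∉ Iic τ := fun h => hu.2 ⟨hu.1, h⟩
        rw [poissonIntegrand, indicator_of_notMem this]
    _ = _ := by
        rw [intervalIntegral.integral_const_mul, hsubst,
          Complex.cpow_add _ _ (Complex.ofReal_ne_zero.2 hτ.ne'), Complex.cpow_one]
        ring

lemma tendsto_besselSeries_atTop {q : ℂ} (hq : -1 < q.re) :
    Tendsto (fun τ : ℝ => (τ : ℂ) ^ (q + 1) * (Real.exp (-τ) : ℂ) *
      besselSeries (q + 1 / 2) ((τ / 2) ^ 2)) atTop (𝓝 (2 ^ q / (Real.sqrt Real.pi : ℂ))) := by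
  have hre : 0 < (q + 1).re := by rw [Complex.add_re, Complex.one_re]; linarith
  have hΓ : Complex.Gamma (q + 1) ≠ 0 := Complex.Gamma_ne_zero_of_re_pos hre
  have hπ : (Real.sqrt Real.pi : ℂ) ≠ 0 :=
    Complex.ofReal_ne_zero.2 (Real.sqrt_pos.2 Real.pi_pos).ne'
  have hlim : Tendsto (fun τ => ∫ u in Ioi (0 : ℝ), poissonIntegrand q τ u) atTop
      (𝓝 (∫ u in Ioi (0 : ℝ), (Real.exp (-u) : ℂ) * (u : ℂ) ^ q * 2 ^ q)) := by
    refine tendsto_integral_filter_of_dominated_convergence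
      (fun u => Real.exp (-u) * u ^ q.re * (2 * 2 ^ |q.re|))
      (Eventually.of_forall fun τ => ?_) (Eventually.of_forall fun τ => ?_)
      ((integrableOn_exp_mul_rpow hq).mul_const _)
      (Eventually.of_forall (tendsto_poissonIntegrand q))
    · exact ((Measurable.aestronglyMeasurable (by fun_prop)).indicator measurableSet_Iic)
    · filter_upwards [ae_restrict_mem measurableSet_Ioi] with u hu
      exact norm_poissonIntegrand_le q hu
  have hval : ∫ u in Ioi (0 : ℝ), (Real.exp (-u) : ℂ) * (u : ℂ) ^ q * 2 ^ q =
      Complex.Gamma (q + 1) * 2 ^ q := by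
    rw [integral_mul_const, Gamma_add_one_eq_integral hq]
  rw [hval] at hlim
  have hfin := hlim.const_mul ((Real.sqrt Real.pi : ℂ) * Complex.Gamma (q + 1))⁻¹
  have hconst : ((Real.sqrt Real.pi : ℂ) * Complex.Gamma (q + 1))⁻¹ *
      (Complex.Gamma (q + 1) * 2 ^ q) = 2 ^ q / (Real.sqrt Real.pi : ℂ) := by
    field_simp
  rw [hconst] at hfin
  refine hfin.congr' ?_
  filter_upwards [eventually_gt_atTop 0] with τ hτ
  rw [integral_poissonIntegrand hq hτ, inv_mul_cancel_left₀ (mul_ne_zero hπ hΓ)]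

/-! ### The connection formula -/

lemma wronskian_eq_of_tendsto {f f₁ g g₁ Q : ℂ → ℂ}
    (hf : ∀ z ∈ Complex.slitPlane, HasDerivAt f (f₁ z) z)
    (hf₁ : ∀ z ∈ Complex.slitPlane, HasDerivAt f₁ (Q z * f z) z)
    (hg : ∀ z ∈ Complex.slitPlane, HasDerivAt g (g₁ z) z)
    (hg₁ : ∀ z ∈ Complex.slitPlane, HasDerivAt g₁ (Q z * g z) z)
    {l : Filter ℝ} [l.NeBot] (hl : ∀ᶠ τ in l, 0 < τ) {c : ℂ}
    (hc : Tendsto (fun τ : ℝ => f τ * g₁ τ - f₁ τ * g τ) l (𝓝 c))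
    {z : ℂ} (hz : z ∈ Complex.slitPlane) : f z * g₁ z - f₁ z * g z = c := by
  have hderiv : ∀ w ∈ Complex.slitPlane, HasDerivAt (fun w => f w * g₁ w - f₁ w * g w) 0 w :=
    fun w hw => (((hf w hw).mul (hg₁ w hw)).sub ((hf₁ w hw).mul (hg w hw))).congr_deriv (by ring)
  have hconst : ∀ τ : ℝ, 0 < τ → f τ * g₁ τ - f₁ τ * g τ = f z * g₁ z - f₁ z * g z := fun τ hτ =>
    Complex.isOpen_slitPlane.is_const_of_deriv_eq_zero
      (Complex.starConvex_one_slitPlane.isPathConnected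
        Complex.one_mem_slitPlane).isConnected.isPreconnected
      (fun w hw => (hderiv w hw).differentiableAt.differentiableWithinAt)
      (fun w hw => (hderiv w hw).deriv) (Complex.ofReal_mem_slitPlane.2 hτ) hz
  exact tendsto_nhds_unique (tendsto_const_nhds.congr' (hl.mono fun τ hτ => (hconst τ hτ).symm)) hc

/-- The solution `e^{-z} k(z)`, `k = laplaceInt q q`, of `u'' = (1 + q (q + 1) / z²) u`; it decays
at `+∞`. -/
def decaying (q z : ℂ) : ℂ := Complex.exp (-z) * laplaceInt q q z

/-- The derivative of `decaying`. -/
def decayingDeriv (q z : ℂ) : ℂ := Complex.exp (-z) * (laplaceDeriv q z - laplaceInt q q z)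

section Decaying

variable {q z : ℂ} (hq : -1 < q.re) (hq0 : q.re ≤ 0) (hz : z ∈ Complex.slitPlane)
include hq hq0 hz

lemma hasDerivAt_decaying : HasDerivAt (decaying q) (decayingDeriv q z) z :=
  ((hasDerivAt_neg z).cexp.mul (hasDerivAt_laplaceInt_self hq hq0 hz)).congr_deriv (by
    rw [decayingDeriv]
    ring)

lemma hasDerivAt_decayingDeriv :
    HasDerivAt (decayingDeriv q) ((1 + q * (q + 1) / z ^ 2) * decaying q z) z := by
  refine ((hasDerivAt_neg z).cexp.mul ((hasDerivAt_laplaceDeriv hq hq0 hz).sub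
    (hasDerivAt_laplaceInt_self hq hq0 hz))).congr_deriv ?_
  simp only [Pi.sub_apply, decaying, laplaceDerivTwo]
  ring

end Decaying

/-- The solution `z^{ν+1/2} S_ν(z²/4)` of `u'' = (1 + (ν² - 1/4) / z²) u`, a multiple of
`√z I_ν(z)`; it grows at `+∞`. -/
def growing (ν z : ℂ) : ℂ := z ^ (ν + 1 / 2) * besselSeries ν ((z / 2) ^ 2)

/-- The cofactor of `z^{ν-1/2}` in the derivative of `growing`. -/
def growingCofactor (ν z : ℂ) : ℂ :=
  (ν + 1 / 2) * besselSeries ν ((z / 2) ^ 2) + z ^ 2 / 2 * besselSeries (ν + 1) ((z / 2) ^ 2)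

/-- The derivative of `growing`. -/
def growingDeriv (ν z : ℂ) : ℂ := z ^ (ν - 1 / 2) * growingCofactor ν z

lemma cpow_add_half_eq {z : ℂ} (hz : z ≠ 0) (ν : ℂ) : z ^ (ν + 1 / 2) = z ^ (ν - 1 / 2) * z := by
  rw [show ν + 1 / 2 = ν - 1 / 2 + 1 by ring, Complex.cpow_add _ _ hz, Complex.cpow_one]

lemma hasDerivAt_besselSeries_sq (ν z : ℂ) :
    HasDerivAt (fun w : ℂ => besselSeries ν ((w / 2) ^ 2))
      (z / 2 * besselSeries (ν + 1) ((z / 2) ^ 2)) z := by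
  have hsq : HasDerivAt (fun w : ℂ => (w / 2) ^ 2) (z / 2) z :=
    (((hasDerivAt_id' z).div_const 2).fun_pow 2).congr_deriv (by push_cast; ring)
  exact ((hasDerivAt_besselSeries ν ((z / 2) ^ 2)).comp z hsq).congr_deriv (mul_comm _ _)

lemma hasDerivAt_growing (ν : ℂ) {z : ℂ} (hz : z ∈ Complex.slitPlane) :
    HasDerivAt (growing ν) (growingDeriv ν z) z := by
  refine (((hasDerivAt_id' z).cpow_const (c := ν + 1 / 2) hz).mul
    (hasDerivAt_besselSeries_sq ν z)).congr_deriv ?_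
  rw [growingDeriv, growingCofactor, cpow_add_half_eq (Complex.slitPlane_ne_zero hz),
    show ν + 1 / 2 - 1 = ν - 1 / 2 by ring]
  ring

lemma hasDerivAt_growingCofactor (ν z : ℂ) :
    HasDerivAt (growingCofactor ν) (z / 2 * ((ν + 1 / 2) * besselSeries (ν + 1) ((z / 2) ^ 2)) +
      (z * besselSeries (ν + 1) ((z / 2) ^ 2) +
        z ^ 2 / 2 * (z / 2 * besselSeries (ν + 2) ((z / 2) ^ 2)))) z := by
  have hsq : HasDerivAt (fun w : ℂ => w ^ 2 / 2) z z :=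
    ((hasDerivAt_pow 2 z).div_const 2).congr_deriv (by push_cast; ring)
  refine (((hasDerivAt_besselSeries_sq ν z).const_mul (ν + 1 / 2)).add
    (hsq.mul (hasDerivAt_besselSeries_sq (ν + 1) z))).congr_deriv ?_
  rw [show ν + 1 + 1 = ν + 2 by ring]
  ring

lemma hasDerivAt_growingDeriv (ν : ℂ) {z : ℂ} (hz : z ∈ Complex.slitPlane) :
    HasDerivAt (growingDeriv ν) ((1 + (ν ^ 2 - 1 / 4) / z ^ 2) * growing ν z) z := by
  have hz0 : z ≠ 0 := Complex.slitPlane_ne_zero hz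
  refine (((hasDerivAt_id' z).cpow_const (c := ν - 1 / 2) hz).mul
    (hasDerivAt_growingCofactor ν z)).congr_deriv ?_
  rw [growingCofactor, growing, cpow_add_half_eq hz0, Complex.cpow_sub _ _ hz0, Complex.cpow_one,
    ← besselSeries_recurrence ν ((z / 2) ^ 2)]
  field_simp
  ring

lemma tendsto_growing_atTop {ν : ℂ} (hν : -(1 / 2) < ν.re) :
    Tendsto (fun τ : ℝ => (Real.exp (-τ) : ℂ) * growing ν τ) atTop
      (𝓝 (2 ^ (ν - 1 / 2) / (Real.sqrt Real.pi : ℂ))) := by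
  have hre : -1 < (ν - 1 / 2).re := by
    rw [Complex.sub_re, Complex.div_ofNat_re, Complex.one_re]
    linarith
  refine (tendsto_besselSeries_atTop hre).congr fun τ => ?_
  rw [growing, show ν - 1 / 2 + 1 = ν + 1 / 2 by ring, sub_add_cancel]
  ring

lemma tendsto_ofReal_inv_atTop : Tendsto (fun τ : ℝ => (τ : ℂ)⁻¹) atTop (𝓝 0) :=
  tendsto_inv₀_cobounded.comp (RCLike.tendsto_ofReal_atTop_cobounded ℂ)

lemma growingDeriv_eq (ν : ℂ) {z : ℂ} (hz : z ≠ 0) :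
    growingDeriv ν z = (ν + 1 / 2) * (z⁻¹ * growing ν z) + 1 / 2 * growing (ν + 1) z := by
  rw [growing, growing, growingDeriv, growingCofactor, cpow_add_half_eq hz, cpow_add_half_eq hz,
    show ν + 1 - 1 / 2 = ν + 1 / 2 by ring, cpow_add_half_eq hz]
  field_simp

lemma tendsto_growingDeriv_atTop {ν : ℂ} (hν : -(1 / 2) < ν.re) :
    Tendsto (fun τ : ℝ => (Real.exp (-τ) : ℂ) * growingDeriv ν τ) atTop
      (𝓝 (2 ^ (ν - 1 / 2) / (Real.sqrt Real.pi : ℂ))) := by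
  have hν1 : -(1 / 2) < (ν + 1).re := by
    rw [Complex.add_re, Complex.one_re]
    linarith
  have hlim := ((tendsto_ofReal_inv_atTop.mul (tendsto_growing_atTop hν)).const_mul
    (ν + 1 / 2)).add ((tendsto_growing_atTop hν1).const_mul (1 / 2))
  have hval : (ν + 1 / 2) * (0 * (2 ^ (ν - 1 / 2) / (Real.sqrt Real.pi : ℂ))) +
      1 / 2 * (2 ^ (ν + 1 - 1 / 2) / (Real.sqrt Real.pi : ℂ)) =
      2 ^ (ν - 1 / 2) / (Real.sqrt Real.pi : ℂ) := by
    rw [show ν + 1 - 1 / 2 = ν + 1 / 2 by ring, cpow_add_half_eq two_ne_zero]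
    ring
  rw [hval] at hlim
  refine hlim.congr' ?_
  filter_upwards [eventually_ne_atTop 0] with τ hτ
  rw [growingDeriv_eq ν (Complex.ofReal_ne_zero.2 hτ)]
  ring

lemma wronskian_decaying_growing {ν μ z : ℂ} (hν : |ν.re| < 1 / 2) (hμ : -(1 / 2) < μ.re)
    (hsq : μ ^ 2 = ν ^ 2) (hz : z ∈ Complex.slitPlane) :
    decaying (ν - 1 / 2) z * growingDeriv μ z - decayingDeriv (ν - 1 / 2) z * growing μ z =
      2 * Complex.Gamma (ν + 1 / 2) * (2 ^ (μ - 1 / 2) / (Real.sqrt Real.pi : ℂ)) := by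
  have hre : (ν - 1 / 2).re = ν.re - 1 / 2 := by
    rw [Complex.sub_re, Complex.div_ofNat_re, Complex.one_re]
  have hq : -1 < (ν - 1 / 2).re := by linarith [(abs_lt.1 hν).1]
  have hq0 : (ν - 1 / 2).re ≤ 0 := by linarith [(abs_lt.1 hν).2]
  have hslit : ∀ᶠ τ : ℝ in atTop, (τ : ℂ) ∈ Complex.slitPlane :=
    (eventually_gt_atTop 0).mono fun τ => Complex.ofReal_mem_slitPlane.2
  have hray : ∀ᶠ τ : ℝ in atTop, RayBound 1 (τ : ℂ) :=
    (eventually_ge_atTop 0).mono fun τ hτ => rayBound_one hτ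
  have hk := tendsto_laplaceInt_Gamma one_pos hq hq0 hslit hray tendsto_ofReal_inv_atTop
  have hk' := tendsto_laplaceDeriv_zero one_pos hq hq0 hslit hray tendsto_ofReal_inv_atTop
  have hlim := (hk.mul (tendsto_growingDeriv_atTop hμ)).sub
    ((hk'.sub hk).mul (tendsto_growing_atTop hμ))
  refine wronskian_eq_of_tendsto (Q := fun z => 1 + (ν ^ 2 - 1 / 4) / z ^ 2)
    (fun w hw => hasDerivAt_decaying hq hq0 hw) (fun w hw => ?_)
    (fun w hw => hasDerivAt_growing μ hw) (fun w hw => ?_) (eventually_gt_atTop 0) ?_ hz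
  · exact (hasDerivAt_decayingDeriv hq hq0 hw).congr_deriv (by ring)
  · rw [← hsq]
    exact hasDerivAt_growingDeriv μ hw
  · refine (hlim.congr fun τ => ?_).trans_eq ?_
    · rw [decaying, decayingDeriv]
      push_cast
      ring
    · rw [show ν - 1 / 2 + 1 = ν + 1 / 2 by ring]
      ring_nf

lemma growing_neg_mul_growingDeriv (ν : ℂ) {z : ℂ} (hz : z ≠ 0) :
    growing (-ν) z * growingDeriv ν z =
      besselSeries (-ν) ((z / 2) ^ 2) * growingCofactor ν z := by
  have hpow : z ^ (-ν + 1 / 2) * z ^ (ν - 1 / 2) = 1 := by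
    rw [← Complex.cpow_add _ _ hz, show -ν + 1 / 2 + (ν - 1 / 2) = 0 by ring, Complex.cpow_zero]
  rw [growing, growingDeriv, mul_mul_mul_comm, mul_comm (_ ^ (-ν + 1 / 2)), mul_comm (_ ^ _),
    hpow, one_mul]

lemma besselSeries_neg_mul_growingCofactor_zero (ν : ℂ) :
    besselSeries (-ν) 0 * growingCofactor ν 0 - besselSeries ν 0 * growingCofactor (-ν) 0 =
      2 * Complex.sin (Real.pi * ν) / Real.pi := by
  have hrefl : (Complex.Gamma (1 - ν))⁻¹ * (Complex.Gamma ν)⁻¹ =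
      Complex.sin (Real.pi * ν) / Real.pi := by
    rw [← mul_inv_rev, Complex.Gamma_mul_Gamma_one_sub, inv_div]
  simp only [growingCofactor, zero_div, ne_eq, OfNat.ofNat_ne_zero, not_false_eq_true, zero_pow,
    zero_mul, add_zero, besselSeries_zero]
  rw [mul_div_assoc, ← hrefl, Complex.one_div_Gamma_eq_self_mul_one_div_Gamma_add_one ν,
    neg_add_eq_sub]
  ring

lemma wronskian_growing_growing (ν : ℂ) {z : ℂ} (hz : z ∈ Complex.slitPlane) :
    growing (-ν) z * growingDeriv ν z - growingDeriv (-ν) z * growing ν z =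
      2 * Complex.sin (Real.pi * ν) / Real.pi := by
  have hcont : Continuous fun w : ℂ => besselSeries (-ν) ((w / 2) ^ 2) * growingCofactor ν w -
      besselSeries ν ((w / 2) ^ 2) * growingCofactor (-ν) w := by
    have hS : ∀ μ : ℂ, Continuous fun w : ℂ => besselSeries μ ((w / 2) ^ 2) := fun μ =>
      continuous_iff_continuousAt.2 fun w => (hasDerivAt_besselSeries_sq μ w).continuousAt
    have hC : ∀ μ : ℂ, Continuous (growingCofactor μ) := fun μ =>
      continuous_iff_continuousAt.2 fun w => (hasDerivAt_growingCofactor μ w).continuousAt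
    exact ((hS (-ν)).mul (hC ν)).sub ((hS ν).mul (hC (-ν)))
  have hlim := ((hcont.comp Complex.continuous_ofReal).tendsto 0).mono_left
    (nhdsWithin_le_nhds (s := Ioi 0))
  simp only [Function.comp_def, Complex.ofReal_zero, zero_div, ne_eq, OfNat.ofNat_ne_zero,
    not_false_eq_true, zero_pow, besselSeries_neg_mul_growingCofactor_zero] at hlim
  refine wronskian_eq_of_tendsto (Q := fun z => 1 + (ν ^ 2 - 1 / 4) / z ^ 2) (l := 𝓝[>] 0)
    (fun w hw => hasDerivAt_growing (-ν) hw) (fun w hw => ?_)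
    (fun w hw => hasDerivAt_growing ν hw) (fun w hw => hasDerivAt_growingDeriv ν hw)
    self_mem_nhdsWithin (hlim.congr' ?_) hz
  · rw [← neg_sq ν]
    exact hasDerivAt_growingDeriv (-ν) hw
  · filter_upwards [self_mem_nhdsWithin] with τ (hτ : 0 < τ)
    have hτ0 : (τ : ℂ) ≠ 0 := Complex.ofReal_ne_zero.2 hτ.ne'
    have hswap := growing_neg_mul_growingDeriv (-ν) hτ0
    rw [neg_neg] at hswap
    rw [growing_neg_mul_growingDeriv ν hτ0, mul_comm (growingDeriv _ _), hswap]

-- Solve the two Wronskians with `decaying` for `decaying` itself.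
lemma decaying_connection {ν z : ℂ} (hν : |ν.re| < 1 / 2) (hz : z ∈ Complex.slitPlane) :
    decaying (ν - 1 / 2) z * (2 * Complex.sin (Real.pi * ν) / Real.pi) =
      2 * Complex.Gamma (ν + 1 / 2) / (Real.sqrt Real.pi : ℂ) *
        (2 ^ (ν - 1 / 2) * growing (-ν) z - 2 ^ (-ν - 1 / 2) * growing ν z) := by
  have hre : -(1 / 2) < (-ν).re := by
    rw [Complex.neg_re]
    linarith [(abs_lt.1 hν).2]
  have hpos := wronskian_decaying_growing hν (abs_lt.1 hν).1 rfl hz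
  have hneg := wronskian_decaying_growing hν hre (neg_sq ν) hz
  rw [← wronskian_growing_growing ν hz]
  linear_combination growing (-ν) z * hpos - growing ν z * hneg

lemma I_mul_ofReal_cpow {w : ℝ} (hw : 0 < w) (a : ℂ) :
    (Complex.I * (w : ℂ)) ^ a = Complex.I ^ a * (w : ℂ) ^ a := by
  have hw0 : (w : ℂ) ≠ 0 := Complex.ofReal_ne_zero.2 hw.ne'
  rw [mul_comm, Complex.cpow_def_of_ne_zero (mul_ne_zero hw0 Complex.I_ne_zero),
    Complex.cpow_def_of_ne_zero hw0, Complex.cpow_def_of_ne_zero Complex.I_ne_zero,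
    Complex.log_ofReal_mul hw Complex.I_ne_zero, ← Complex.exp_add, Complex.ofReal_log hw.le]
  ring_nf

lemma ofReal_sqrt_eq_cpow {w : ℝ} (hw : 0 ≤ w) : (Real.sqrt w : ℂ) = (w : ℂ) ^ (1 / 2 : ℂ) := by
  rw [Real.sqrt_eq_rpow, Complex.ofReal_cpow hw]
  norm_num

lemma I_mul_ofReal_mem_slitPlane {w : ℝ} (hw : w ≠ 0) : Complex.I * (w : ℂ) ∈ Complex.slitPlane :=
  Or.inr (by simpa using hw)

lemma growing_I_mul (ν : ℂ) {w : ℝ} (hw : 0 < w) :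
    2 ^ (-ν - 1 / 2) * growing ν (Complex.I * w) * (Real.sqrt 2 : ℂ) =
      Complex.I ^ (ν + 1 / 2) * (Real.sqrt w : ℂ) * besselJ ν w := by
  have hw0 : (w : ℂ) ≠ 0 := Complex.ofReal_ne_zero.2 hw.ne'
  have hscale : (w : ℂ) ^ ν = 2 ^ ν * (w / 2) ^ ν := by
    have := Complex.mul_cpow_ofReal_nonneg zero_le_two (half_pos hw).le ν
    rwa [← Complex.ofReal_mul, mul_div_cancel₀ _ two_ne_zero, Complex.ofReal_div,
      Complex.ofReal_ofNat] at this
  have hpow : (2 : ℂ) ^ (-ν - 1 / 2) * 2 ^ (1 / 2 : ℂ) * 2 ^ ν = 1 := by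
    rw [← Complex.cpow_add _ _ two_ne_zero, ← Complex.cpow_add _ _ two_ne_zero,
      show -ν - 1 / 2 + 1 / 2 + ν = 0 by ring, Complex.cpow_zero]
  have hsq : (Complex.I * (w : ℂ) / 2) ^ 2 = -((w : ℂ) / 2) ^ 2 := by
    rw [mul_div_assoc, mul_pow, Complex.I_sq, neg_one_mul]
  rw [growing, besselJ_eq, I_mul_ofReal_cpow hw, Complex.cpow_add ν (1 / 2) hw0, hscale, hsq,
    ofReal_sqrt_eq_cpow hw.le, ofReal_sqrt_eq_cpow zero_le_two, Complex.ofReal_ofNat]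
  linear_combination (Complex.I ^ (ν + 1 / 2) * (w : ℂ) ^ (1 / 2 : ℂ) * ((w : ℂ) / 2) ^ ν *
    besselSeries ν (-((w : ℂ) / 2) ^ 2)) * hpow

lemma ne_intCast_of_abs_re_lt {ν : ℂ} (hν0 : ν ≠ 0) (hν : |ν.re| < 1) (n : ℤ) : ν ≠ n := by
  rintro rfl
  rw [Complex.intCast_re] at hν
  have hn : |n| < 1 := by exact_mod_cast hν
  exact hν0 (by rw [Int.abs_lt_one_iff.1 hn, Int.cast_zero])

lemma sin_pi_mul_ne_zero {ν : ℂ} (hν0 : ν ≠ 0) (hν : |ν.re| < 1) :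
    Complex.sin (Real.pi * ν) ≠ 0 := by
  refine Complex.sin_ne_zero_iff.2 fun k hk => ne_intCast_of_abs_re_lt hν0 hν k ?_
  rw [mul_comm] at hk
  exact mul_right_cancel₀ (Complex.ofReal_ne_zero.2 Real.pi_ne_zero) hk

lemma I_cpow_mul_I_cpow_neg (ν : ℂ) :
    Complex.I ^ (ν + 1 / 2) * Complex.I ^ (-ν + 1 / 2) = Complex.I := by
  rw [← Complex.cpow_add _ _ Complex.I_ne_zero, show ν + 1 / 2 + (-ν + 1 / 2) = 1 by ring,
    Complex.cpow_one]

lemma I_cpow_mul_I_cpow_self (ν : ℂ) : Complex.I ^ (ν + 1 / 2) * Complex.I ^ (ν + 1 / 2) =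
    Complex.I * (Complex.cos (Real.pi * ν) + Complex.sin (Real.pi * ν) * Complex.I) := by
  rw [← Complex.cpow_add _ _ Complex.I_ne_zero, ← Complex.exp_mul_I,
    show ν + 1 / 2 + (ν + 1 / 2) = 1 + 2 * ν by ring, Complex.cpow_add _ _ Complex.I_ne_zero,
    Complex.cpow_one, Complex.cpow_def_of_ne_zero Complex.I_ne_zero, Complex.log_I]
  ring_nf

lemma Gamma_add_half_ne_zero {ν : ℂ} (hν : -(1 / 2) < ν.re) : Complex.Gamma (ν + 1 / 2) ≠ 0 := by
  refine Complex.Gamma_ne_zero_of_re_pos ?_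
  rw [Complex.add_re, Complex.div_ofNat_re, Complex.one_re]
  linarith

lemma decaying_I_mul {ν : ℂ} (hν : |ν.re| < 1 / 2) {w : ℝ} (hw : 0 < w) :
    decaying (ν - 1 / 2) (Complex.I * w) * Complex.sin (Real.pi * ν) * (Real.sqrt 2 : ℂ) =
      Complex.Gamma (ν + 1 / 2) * (Real.sqrt Real.pi : ℂ) * (Real.sqrt w : ℂ) *
        (Complex.I ^ (-ν + 1 / 2) * besselJ (-ν) w - Complex.I ^ (ν + 1 / 2) * besselJ ν w) := by
  have hπ : (Real.sqrt Real.pi : ℂ) ≠ 0 :=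
    Complex.ofReal_ne_zero.2 (Real.sqrt_pos.2 Real.pi_pos).ne'
  have hπ2 : (Real.pi : ℂ) = (Real.sqrt Real.pi : ℂ) ^ 2 := by
    rw [← Complex.ofReal_pow, Real.sq_sqrt Real.pi_pos.le]
  have hpos := growing_I_mul ν hw
  have hneg := growing_I_mul (-ν) hw
  rw [neg_neg] at hneg
  have hconn : decaying (ν - 1 / 2) (Complex.I * w) * Complex.sin (Real.pi * ν) =
      Complex.Gamma (ν + 1 / 2) * (Real.sqrt Real.pi : ℂ) *
        (2 ^ (ν - 1 / 2) * growing (-ν) (Complex.I * w) -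
          2 ^ (-ν - 1 / 2) * growing ν (Complex.I * w)) := by
    have h := decaying_connection hν (I_mul_ofReal_mem_slitPlane hw.ne')
    generalize Complex.sin (Real.pi * ν) = s at h ⊢
    rw [hπ2] at h
    generalize (2 : ℂ) ^ (ν - 1 / 2) = a at h ⊢
    generalize (2 : ℂ) ^ (-ν - 1 / 2) = b at h ⊢
    generalize decaying (ν - 1 / 2) (Complex.I * w) = D at h ⊢
    generalize Complex.Gamma (ν + 1 / 2) = Γ at h ⊢
    field_simp at h
    linear_combination h
  linear_combination (Real.sqrt 2 : ℂ) * hconn +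
    Complex.Gamma (ν + 1 / 2) * (Real.sqrt Real.pi : ℂ) * (hneg - hpos)

/-- The ratio of `√w H_ν^{(2)}(w)` to `decaying (ν - 1/2) (iw)`. -/
def hankelConst (ν : ℂ) : ℂ :=
  Complex.I ^ (ν + 1 / 2) * ((Real.sqrt 2 : ℂ) / (Real.sqrt Real.pi : ℂ)) *
    (Complex.Gamma (ν + 1 / 2))⁻¹

lemma sqrt_mul_hankel_of_ne_zero {ν : ℂ} (hν0 : ν ≠ 0) (hν : |ν.re| < 1 / 2) {w : ℝ}
    (hw : 0 < w) :
    (Real.sqrt w : ℂ) * (besselJ ν w - Complex.I * besselYQuot ν w) =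
      hankelConst ν * decaying (ν - 1 / 2) (Complex.I * w) := by
  have hs := sin_pi_mul_ne_zero hν0 (hν.trans one_half_lt_one)
  have hπ : (Real.sqrt Real.pi : ℂ) ≠ 0 :=
    Complex.ofReal_ne_zero.2 (Real.sqrt_pos.2 Real.pi_pos).ne'
  have hΓ := Gamma_add_half_ne_zero (abs_lt.1 hν).1
  have hD := decaying_I_mul hν hw
  have hpm := I_cpow_mul_I_cpow_neg ν
  have hpp := I_cpow_mul_I_cpow_self ν
  refine mul_right_cancel₀ hs ?_
  rw [besselYQuot, hankelConst]
  generalize Complex.sin (Real.pi * ν) = s at hs hD hpp ⊢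
  generalize Complex.I ^ (ν + 1 / 2) = p at hD hpm hpp ⊢
  generalize Complex.I ^ (-ν + 1 / 2) = m at hD hpm
  generalize decaying (ν - 1 / 2) (Complex.I * w) = D at hD ⊢
  generalize Complex.Gamma (ν + 1 / 2) = Γ at hΓ hD ⊢
  calc (Real.sqrt w : ℂ) * (besselJ ν w -
        Complex.I * ((besselJ ν w * Complex.cos (Real.pi * ν) - besselJ (-ν) w) / s)) * s
      = (Real.sqrt w : ℂ) * (Complex.I * besselJ (-ν) w -
          Complex.I * (Complex.cos (Real.pi * ν) + s * Complex.I) * besselJ ν w) := by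
        field_simp
        linear_combination (Real.sqrt w : ℂ) * besselJ ν w * s * Complex.I_mul_I
    _ = p * ((Real.sqrt w : ℂ) *
          (m * besselJ (-ν) w - p * besselJ ν w)) := by
        linear_combination (Real.sqrt w : ℂ) * besselJ ν w * hpp -
          (Real.sqrt w : ℂ) * besselJ (-ν) w * hpm
    _ = _ := by
        field_simp
        linear_combination -p * hD

lemma continuous_hankelConst : Continuous hankelConst := by
  have hpow : Continuous fun ν : ℂ => Complex.I ^ (ν + 1 / 2) :=
    (continuous_id.add_const _).const_cpow (Or.inl Complex.I_ne_zero)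
  exact (hpow.mul_const _).mul
    (Complex.differentiable_one_div_Gamma.continuous.comp (continuous_id.add_const _))

lemma continuous_besselJ_order {w : ℂ} (hw : w ≠ 0) : Continuous fun ν => besselJ ν w := by
  simp only [besselJ_eq]
  exact (continuous_id.const_cpow (Or.inl (div_ne_zero hw two_ne_zero))).mul
    (continuous_besselSeries_order _)

lemma continuousAt_decaying_order {ν : ℂ} (hν : |ν.re| < 1 / 2) {z : ℂ}
    (hz : z ∈ Complex.slitPlane) : ContinuousAt (fun μ => decaying (μ - 1 / 2) z) ν := by
  have hre : (ν - 1 / 2).re = ν.re - 1 / 2 := by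
    rw [Complex.sub_re, Complex.div_ofNat_re, Complex.one_re]
  obtain ⟨hlt, hgt⟩ := abs_lt.1 hν
  exact continuousAt_const.mul ((continuousAt_laplaceInt_order (by linarith) (by linarith)
    hz).comp (f := fun μ : ℂ => μ - 1 / 2) (by fun_prop))

lemma tendsto_besselYQuot_zero {w : ℝ} (hw : 0 < w) :
    Tendsto (fun μ : ℂ => besselYQuot μ w) (𝓝[≠] 0) (𝓝 (Complex.I *
      (hankelConst 0 * decaying (0 - 1 / 2) (Complex.I * w) / (Real.sqrt w : ℂ) -
        besselJ 0 w))) := by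
  have hw0 : (w : ℂ) ≠ 0 := Complex.ofReal_ne_zero.2 hw.ne'
  have hsw : (Real.sqrt w : ℂ) ≠ 0 := Complex.ofReal_ne_zero.2 (Real.sqrt_pos.2 hw).ne'
  have hcont : ContinuousAt (fun μ : ℂ => Complex.I *
      (hankelConst μ * decaying (μ - 1 / 2) (Complex.I * w) / (Real.sqrt w : ℂ) -
        besselJ μ w)) 0 :=
    (((continuous_hankelConst.continuousAt.mul (continuousAt_decaying_order (by simp)
      (I_mul_ofReal_mem_slitPlane hw.ne'))).div_const _).sub
        (continuous_besselJ_order hw0).continuousAt).const_mul _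
  refine (hcont.tendsto.mono_left nhdsWithin_le_nhds).congr' ?_
  have hre : ∀ᶠ μ : ℂ in 𝓝[≠] 0, |μ.re| < 1 / 2 :=
    nhdsWithin_le_nhds ((isOpen_lt (by fun_prop) continuous_const).mem_nhds (by simp))
  filter_upwards [hre, self_mem_nhdsWithin] with μ hμ hμ0
  rw [← sqrt_mul_hankel_of_ne_zero hμ0 hμ hw, mul_div_cancel_left₀ _ hsw]
  linear_combination (-besselYQuot μ w) * Complex.I_mul_I

-- For `ν = 0` the function `Y_0` is a limit in the order, and the formula passes to the limit.
lemma sqrt_mul_hankelH2 {ν : ℂ} (hν : |ν.re| < 1 / 2) {w : ℝ} (hw : 0 < w) :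
    (Real.sqrt w : ℂ) * hankelH2 ν w =
      hankelConst ν * decaying (ν - 1 / 2) (Complex.I * w) := by
  rcases eq_or_ne ν 0 with rfl | hν0
  · have hsw : (Real.sqrt w : ℂ) ≠ 0 := Complex.ofReal_ne_zero.2 (Real.sqrt_pos.2 hw).ne'
    rw [hankelH2, besselY, if_pos ⟨0, by simp⟩, (tendsto_besselYQuot_zero hw).limUnder_eq,
      ← mul_assoc Complex.I, Complex.I_mul_I]
    field_simp
    ring
  · have hint : ¬ ∃ n : ℤ, ν = n := fun ⟨n, hn⟩ =>
      ne_intCast_of_abs_re_lt hν0 (hν.trans one_half_lt_one) n hn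
    rw [hankelH2, besselY, if_neg hint, sqrt_mul_hankel_of_ne_zero hν0 hν hw]

/-! ### The continued kernel -/

lemma neg_one_lt_re_sub_half {ν : ℂ} (hν : |ν.re| < 1 / 2) : -1 < (ν - 1 / 2).re := by
  rw [Complex.sub_re, Complex.div_ofNat_re, Complex.one_re]
  linarith [(abs_lt.1 hν).1]

lemma re_sub_half_neg {ν : ℂ} (hν : |ν.re| < 1 / 2) : (ν - 1 / 2).re < 0 := by
  rw [Complex.sub_re, Complex.div_ofNat_re, Complex.one_re]
  linarith [(abs_lt.1 hν).2]

/-- The argument `ixz/(2t)` of `laplaceInt` in the kernel. -/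
def phase (t x : ℝ) (z : ℂ) : ℂ := Complex.I * (x * z / (2 * t))

/-- The oscillating factor `e^{ia(t)(z-x)²}` of the kernel, `a(t) = 1/(4t)`. -/
def chirp (t x : ℝ) (z : ℂ) : ℂ := Complex.exp (Complex.I * (z - x) ^ 2 / (4 * t))

/-- The constant for which the kernel has the initial value prescribed on the diagonal. -/
def kernelConst (ν : ℂ) : ℂ :=
  (2 * Complex.sqrt (Complex.I * Real.pi) * Complex.Gamma (ν + 1 / 2))⁻¹

/-- The factor of the kernel that depends on time only. -/
def amplitude (ν : ℂ) (t : ℝ) : ℂ := kernelConst ν / (Real.sqrt t : ℂ)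

/-- The reduced kernel `G̃`, for `x` and `z` on the same side of the imaginary axis. -/
def profile (ν : ℂ) (t x : ℝ) (z : ℂ) : ℂ :=
  amplitude ν t * laplaceInt (ν - 1 / 2) (ν - 1 / 2) (phase t x z)

/-- The derivative of `profile` in `x`. -/
def profileX (ν : ℂ) (t x : ℝ) (z : ℂ) : ℂ :=
  amplitude ν t / x * (phase t x z * laplaceDeriv (ν - 1 / 2) (phase t x z))

/-- The second derivative of `profile` in `x`. -/
def profileXX (ν : ℂ) (t x : ℝ) (z : ℂ) : ℂ :=
  amplitude ν t / x ^ 2 * (phase t x z ^ 2 * laplaceDerivTwo (ν - 1 / 2) (phase t x z))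

/-- The derivative of `profile` in `t`. -/
def profileT (ν : ℂ) (t x : ℝ) (z : ℂ) : ℂ :=
  -(amplitude ν t / t) * (laplaceInt (ν - 1 / 2) (ν - 1 / 2) (phase t x z) / 2 +
    phase t x z * laplaceDeriv (ν - 1 / 2) (phase t x z))

/-- The kernel, for `x` and `z` on the same side of the imaginary axis. -/
def kernel (ν : ℂ) (t x : ℝ) (z : ℂ) : ℂ := chirp t x z * profile ν t x z

/-- The derivative of `kernel` in `x`. -/
def kernelX (ν : ℂ) (t x : ℝ) (z : ℂ) : ℂ :=
  chirp t x z * (profileX ν t x z - Complex.I * (z - x) / (2 * t) * profile ν t x z)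

/-- The second derivative of `kernel` in `x`. -/
def kernelXX (ν : ℂ) (t x : ℝ) (z : ℂ) : ℂ :=
  chirp t x z * (profileXX ν t x z - Complex.I * (z - x) / t * profileX ν t x z +
    (Complex.I / (2 * t) - ((z - x) / (2 * t)) ^ 2) * profile ν t x z)

/-- The derivative of `kernel` in `t`. -/
def kernelT (ν : ℂ) (t x : ℝ) (z : ℂ) : ℂ :=
  chirp t x z * (profileT ν t x z - Complex.I * (z - x) ^ 2 / (4 * t ^ 2) * profile ν t x z)

lemma phase_im (t x : ℝ) (z : ℂ) : (phase t x z).im = x * z.re / (2 * t) := by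
  rw [phase, show (x : ℂ) * z / (2 * t) = ((x / (2 * t) : ℝ) : ℂ) * z by push_cast; ring,
    Complex.I_mul_im, Complex.re_ofReal_mul]
  ring

lemma phase_ofReal_re (t x y : ℝ) : (phase t x y).re = 0 := by
  rw [phase, show (x : ℂ) * y / (2 * t) = ((x * y / (2 * t) : ℝ) : ℂ) by push_cast; ring,
    Complex.I_mul_re, Complex.ofReal_im, neg_zero]

lemma hasDerivAt_phase_space (t : ℝ) {x : ℝ} (hx : x ≠ 0) (z : ℂ) :
    HasDerivAt (fun ξ => phase t ξ z) (phase t x z / x) x := by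
  have hx0 : (x : ℂ) ≠ 0 := Complex.ofReal_ne_zero.2 hx
  refine ((((hasDerivAt_id (x : ℂ)).mul_const z).div_const (2 * (t : ℂ))).const_mul
    Complex.I).comp_ofReal.congr_deriv ?_
  rw [phase]
  field_simp

lemma hasDerivAt_phase_time {t : ℝ} (ht : t ≠ 0) (x : ℝ) (z : ℂ) :
    HasDerivAt (fun τ => phase τ x z) (-(phase t x z / t)) t := by
  have ht0 : (t : ℂ) ≠ 0 := Complex.ofReal_ne_zero.2 ht
  refine (((hasDerivAt_inv ht0).const_mul (Complex.I * x * z / 2)).comp_ofReal.congr_deriv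
    ?_).congr_of_eventuallyEq (Eventually.of_forall fun τ => ?_)
  · rw [phase]; field_simp
  · simp only [phase]; ring

lemma hasDerivAt_amplitude (ν : ℂ) {t : ℝ} (ht : 0 < t) :
    HasDerivAt (amplitude ν) (-(amplitude ν t / (2 * t))) t := by
  have hst : (Real.sqrt t : ℂ) ≠ 0 := Complex.ofReal_ne_zero.2 (Real.sqrt_pos.2 ht).ne'
  have hsq : (t : ℂ) = (Real.sqrt t : ℂ) ^ 2 := by rw [← Complex.ofReal_pow, Real.sq_sqrt ht.le]
  refine (((Real.hasDerivAt_sqrt ht.ne').ofReal_comp.inv hst).const_mul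
    (kernelConst ν)).congr_deriv ?_
  rw [amplitude, hsq]
  push_cast
  field_simp

lemma hasDerivAt_chirp_space (t x : ℝ) (z : ℂ) :
    HasDerivAt (fun ξ => chirp t ξ z)
      (chirp t x z * -(Complex.I * (z - x) / (2 * t))) x := by
  have hexponent : HasDerivAt (fun ξ : ℂ => Complex.I * (z - ξ) ^ 2 / (4 * t))
      (-(Complex.I * (z - x) / (2 * t))) x := by
    refine (((((hasDerivAt_id (x : ℂ)).const_sub z).pow 2).const_mul Complex.I).div_const
      (4 * (t : ℂ))).congr_deriv ?_
    simp only [id]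
    push_cast
    ring
  exact hexponent.cexp.comp_ofReal

lemma hasDerivAt_chirp_time {t : ℝ} (ht : t ≠ 0) (x : ℝ) (z : ℂ) :
    HasDerivAt (fun τ => chirp τ x z)
      (chirp t x z * -(Complex.I * (z - x) ^ 2 / (4 * t ^ 2))) t := by
  have ht0 : (t : ℂ) ≠ 0 := Complex.ofReal_ne_zero.2 ht
  have hexponent : HasDerivAt (fun τ : ℂ => Complex.I * (z - x) ^ 2 / (4 * τ))
      (-(Complex.I * (z - x) ^ 2 / (4 * t ^ 2))) t := by
    refine (((hasDerivAt_inv ht0).const_mul (Complex.I * (z - x) ^ 2 / 4)).congr_deriv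
      ?_).congr_of_eventuallyEq (Eventually.of_forall fun τ => ?_) <;> ring
  exact hexponent.cexp.comp_ofReal

lemma hasDerivAt_chirpSlope (t x : ℝ) (z : ℂ) :
    HasDerivAt (fun ξ : ℝ => Complex.I * (z - ξ) / (2 * t)) (-(Complex.I / (2 * t))) x := by
  refine ((((hasDerivAt_id (x : ℂ)).const_sub z).const_mul Complex.I).div_const
    (2 * (t : ℂ))).comp_ofReal.congr_deriv ?_
  ring

section KernelDerivatives

variable {ν : ℂ} {t x : ℝ} {z : ℂ}

lemma phase_mem_slitPlane (ht : 0 < t) (hxz : 0 < x * z.re) :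
    phase t x z ∈ Complex.slitPlane := by
  rw [Complex.mem_slitPlane_iff, phase_im]
  right
  positivity

variable (hν : |ν.re| < 1 / 2) (ht : 0 < t) (hxz : 0 < x * z.re)
include hν ht hxz

lemma hasDerivAt_laplaceInt_phase : HasDerivAt (laplaceInt (ν - 1 / 2) (ν - 1 / 2))
    (laplaceDeriv (ν - 1 / 2) (phase t x z)) (phase t x z) :=
  hasDerivAt_laplaceInt_self (neg_one_lt_re_sub_half hν) (re_sub_half_neg hν).le
    (phase_mem_slitPlane ht hxz)

lemma hasDerivAt_laplaceDeriv_phase : HasDerivAt (laplaceDeriv (ν - 1 / 2))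
    (laplaceDerivTwo (ν - 1 / 2) (phase t x z)) (phase t x z) :=
  hasDerivAt_laplaceDeriv (neg_one_lt_re_sub_half hν) (re_sub_half_neg hν).le
    (phase_mem_slitPlane ht hxz)

lemma hasDerivAt_profile_space :
    HasDerivAt (fun ξ => profile ν t ξ z) (profileX ν t x z) x := by
  have hx : x ≠ 0 := left_ne_zero_of_mul hxz.ne'
  refine (((hasDerivAt_laplaceInt_phase hν ht hxz).comp x
    (hasDerivAt_phase_space t hx z)).const_mul (amplitude ν t)).congr_deriv ?_
  rw [profileX]
  ring

lemma hasDerivAt_profileX :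
    HasDerivAt (fun ξ => profileX ν t ξ z) (profileXX ν t x z) x := by
  have hx : x ≠ 0 := left_ne_zero_of_mul hxz.ne'
  have hx0 : (x : ℂ) ≠ 0 := Complex.ofReal_ne_zero.2 hx
  have hinv := ((hasDerivAt_inv hx0).const_mul (amplitude ν t)).comp_ofReal
  have hphase := hasDerivAt_phase_space t hx z
  refine (hinv.mul (hphase.mul ((hasDerivAt_laplaceDeriv_phase hν ht hxz).comp x
    hphase))).congr_deriv ?_
  simp only [profileXX, Function.comp_apply, Pi.mul_apply]
  field_simp
  ring

lemma hasDerivAt_profile_time :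
    HasDerivAt (fun τ => profile ν τ x z) (profileT ν t x z) t := by
  refine ((hasDerivAt_amplitude ν ht).mul ((hasDerivAt_laplaceInt_phase hν ht hxz).comp t
    (hasDerivAt_phase_time ht.ne' x z))).congr_deriv ?_
  rw [profileT, Function.comp_apply]
  ring

lemma hasDerivAt_kernel_space : HasDerivAt (fun ξ => kernel ν t ξ z) (kernelX ν t x z) x := by
  refine ((hasDerivAt_chirp_space t x z).mul (hasDerivAt_profile_space hν ht hxz)).congr_deriv ?_
  rw [kernelX]
  ring

lemma hasDerivAt_kernelX : HasDerivAt (fun ξ => kernelX ν t ξ z) (kernelXX ν t x z) x := by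
  have hprofile := hasDerivAt_profile_space hν ht hxz
  refine ((hasDerivAt_chirp_space t x z).mul ((hasDerivAt_profileX hν ht hxz).sub
    ((hasDerivAt_chirpSlope t x z).mul hprofile))).congr_deriv ?_
  simp only [kernelXX, Pi.sub_apply, Pi.mul_apply]
  linear_combination
    chirp t x z * profile ν t x z * ((z - x) / (2 * t)) ^ 2 * Complex.I_mul_I

lemma hasDerivAt_kernel_time : HasDerivAt (fun τ => kernel ν τ x z) (kernelT ν t x z) t := by
  refine ((hasDerivAt_chirp_time ht.ne' x z).mul
    (hasDerivAt_profile_time hν ht hxz)).congr_deriv ?_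
  rw [kernelT]
  ring

lemma continuousAt_kernelXX : ContinuousAt (fun ξ => kernelXX ν t ξ z) x := by
  have hx0 : (x : ℂ) ≠ 0 := Complex.ofReal_ne_zero.2 (left_ne_zero_of_mul hxz.ne')
  have hphase := (hasDerivAt_phase_space t (left_ne_zero_of_mul hxz.ne') z).continuousAt
  have hcoeff : ContinuousAt (fun ξ : ℝ => amplitude ν t / (ξ : ℂ) ^ 2) x :=
    continuousAt_const.div (by fun_prop) (pow_ne_zero 2 hx0)
  have hXX : ContinuousAt (fun ξ => profileXX ν t ξ z) x :=
    hcoeff.mul ((hphase.pow 2).mul ((continuousAt_laplaceDerivTwo (neg_one_lt_re_sub_half hν)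
      (re_sub_half_neg hν).le (phase_mem_slitPlane ht hxz)).comp (f := (phase t · z)) hphase))
  exact (hasDerivAt_chirp_space t x z).continuousAt.mul ((hXX.sub (.mul (by fun_prop)
    (hasDerivAt_profileX hν ht hxz).continuousAt)).add
    (.mul (by fun_prop) (hasDerivAt_profile_space hν ht hxz).continuousAt))

lemma continuousAt_kernelT : ContinuousAt (fun τ => kernelT ν τ x z) t := by
  have ht0 : (t : ℂ) ≠ 0 := Complex.ofReal_ne_zero.2 ht.ne'
  have hphase := (hasDerivAt_phase_time ht.ne' x z).continuousAt
  have hcoeff : ContinuousAt (fun τ : ℝ => -(amplitude ν τ / τ)) t :=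
    ((hasDerivAt_amplitude ν ht).continuousAt.div (by fun_prop) ht0).neg
  have hT : ContinuousAt (fun τ => profileT ν τ x z) t :=
    hcoeff.mul ((((hasDerivAt_laplaceInt_phase hν ht hxz).continuousAt.comp
      (f := (phase · x z)) hphase).div_const 2).add
      (hphase.mul ((hasDerivAt_laplaceDeriv_phase hν ht hxz).continuousAt.comp
        (f := (phase · x z)) hphase)))
  have hslope : ContinuousAt (fun τ : ℝ => Complex.I * (z - x) ^ 2 / (4 * (τ : ℂ) ^ 2)) t :=
    continuousAt_const.div (by fun_prop) (by simpa using ht.ne')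
  exact (hasDerivAt_chirp_time ht.ne' x z).continuousAt.mul
    (hT.sub (hslope.mul (hasDerivAt_profile_time hν ht hxz).continuousAt))

lemma differentiableAt_kernel : DifferentiableAt ℂ (kernel ν t x) z := by
  refine DifferentiableAt.mul (by unfold chirp; fun_prop) (DifferentiableAt.const_mul ?_ _)
  exact (hasDerivAt_laplaceInt_phase hν ht hxz).differentiableAt.comp z
    (by unfold phase; fun_prop)

omit hν in
lemma kernel_schroedinger : Complex.I * kernelT ν t x z =
    -kernelXX ν t x z + (ν ^ 2 - 1 / 4) / x ^ 2 * kernel ν t x z := by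
  have hx0 : (x : ℂ) ≠ 0 := Complex.ofReal_ne_zero.2 (left_ne_zero_of_mul hxz.ne')
  have ht0 : (t : ℂ) ≠ 0 := Complex.ofReal_ne_zero.2 ht.ne'
  have hz0 : z ≠ 0 := fun h => by simp [h] at hxz
  simp only [kernelT, kernelXX, kernel, profileT, profileXX, profileX, profile, laplaceDerivTwo]
  generalize laplaceInt (ν - 1 / 2) (ν - 1 / 2) (phase t x z) = k
  generalize laplaceDeriv (ν - 1 / 2) (phase t x z) = k'
  rw [phase]
  field_simp
  linear_combination -(4 * chirp t x z * amplitude ν t * x ^ 2 * k * (z - x) ^ 2) * Complex.I_sq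

end KernelDerivatives

/-- The function that equals `F` where `x` and `Re z` have the same sign and vanishes elsewhere;
this is the Heaviside factor `Θ(xy)` of the kernel for complex `y = z`. -/
def truncate (F : ℝ → ℝ → ℂ → ℂ) (t x : ℝ) (z : ℂ) : ℂ := if 0 < x * z.re then F t x z else 0

/-- The continuation of the kernel to complex `y`. -/
def greenExt (ν : ℂ) : ℝ → ℝ → ℂ → ℂ := truncate (kernel ν)

lemma ite_pos_eventuallyEq {X : Type*} [TopologicalSpace X] {r : X → ℝ} {p : X}
    (hr : ContinuousAt r p) (hp : r p ≠ 0) (f : X → ℂ) :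
    (fun q => if 0 < r q then f q else 0) =ᶠ[𝓝 p] if 0 < r p then f else fun _ => 0 := by
  rcases hp.lt_or_gt with hneg | hpos
  · filter_upwards [hr.eventually (gt_mem_nhds hneg)] with q hq
    rw [if_neg hq.not_gt, if_neg hneg.not_gt]
  · filter_upwards [hr.eventually (lt_mem_nhds hpos)] with q hq
    rw [if_pos hq, if_pos hpos]

section Truncate

variable {F F₁ : ℝ → ℝ → ℂ → ℂ} {t x : ℝ} {z : ℂ}

lemma truncate_space_eventuallyEq (F : ℝ → ℝ → ℂ → ℂ) (t : ℝ) (hx : x ≠ 0) (hz : z.re ≠ 0) :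
    (fun ξ => truncate F t ξ z) =ᶠ[𝓝 x] if 0 < x * z.re then (fun ξ => F t ξ z) else fun _ => 0 :=
  ite_pos_eventuallyEq (r := fun ξ : ℝ => ξ * z.re) (by fun_prop) (mul_ne_zero hx hz) _

lemma hasDerivAt_truncate_space (hx : x ≠ 0) (hz : z.re ≠ 0)
    (h : 0 < x * z.re → HasDerivAt (fun ξ => F t ξ z) (F₁ t x z) x) :
    HasDerivAt (fun ξ => truncate F t ξ z) (truncate F₁ t x z) x := by
  refine HasDerivAt.congr_of_eventuallyEq ?_ (truncate_space_eventuallyEq F t hx hz)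
  rw [truncate]
  split_ifs with hxz
  · exact h hxz
  · exact hasDerivAt_const x 0

lemma continuousAt_truncate_space (hx : x ≠ 0) (hz : z.re ≠ 0)
    (h : 0 < x * z.re → ContinuousAt (fun ξ => F t ξ z) x) :
    ContinuousAt (fun ξ => truncate F t ξ z) x := by
  refine ContinuousAt.congr_of_eventuallyEq ?_ (truncate_space_eventuallyEq F t hx hz)
  split_ifs with hxz
  · exact h hxz
  · exact continuousAt_const

lemma hasDerivAt_truncate_time (h : 0 < x * z.re → HasDerivAt (fun τ => F τ x z) (F₁ t x z) t) :
    HasDerivAt (fun τ => truncate F τ x z) (truncate F₁ t x z) t := by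
  unfold truncate
  split_ifs with hxz
  · exact h hxz
  · exact hasDerivAt_const t 0

lemma continuousAt_truncate_time (h : 0 < x * z.re → ContinuousAt (fun τ => F τ x z) t) :
    ContinuousAt (fun τ => truncate F τ x z) t := by
  unfold truncate
  split_ifs with hxz
  · exact h hxz
  · exact continuousAt_const

lemma differentiableAt_truncate (hx : x ≠ 0) (hz : z.re ≠ 0)
    (h : 0 < x * z.re → DifferentiableAt ℂ (F t x) z) :
    DifferentiableAt ℂ (truncate F t x) z := by
  refine DifferentiableAt.congr_of_eventuallyEq ?_ (ite_pos_eventuallyEq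
    (r := fun w : ℂ => x * w.re) (by fun_prop) (mul_ne_zero hx hz) (F t x))
  split_ifs with hxz
  · exact h hxz
  · exact differentiableAt_const 0

lemma norm_truncate_le {B : ℝ} (hB : 0 ≤ B) (h : 0 < x * z.re → ‖F t x z‖ ≤ B) :
    ‖truncate F t x z‖ ≤ B := by
  rw [truncate]
  split_ifs with hxz
  · exact h hxz
  · rwa [norm_zero]

end Truncate

lemma hasDerivAt_deriv_of_ne_zero {f f₁ : ℝ → ℂ} {f₂ : ℂ} {x : ℝ}
    (hf : ∀ ξ ≠ 0, HasDerivAt f (f₁ ξ) ξ) (hf₁ : HasDerivAt f₁ f₂ x) (hx : x ≠ 0) :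
    HasDerivAt (deriv f) f₂ x :=
  hf₁.congr_of_eventuallyEq <| (eventually_ne_nhds hx).mono fun ξ hξ => (hf ξ hξ).deriv

lemma AC_of_hasDerivAt {E : Type*} [NormedAddCommGroup E] [NormedSpace ℝ E] [CompleteSpace E]
    {f f' : ℝ → E} {I : Set ℝ} (hI : I.OrdConnected) (hf : ∀ t ∈ I, HasDerivAt f (f' t) t)
    (hf' : ContinuousOn f' I) : AC f I := by
  refine ⟨f', hf'.locallyIntegrableOn hI.measurableSet, fun x hx y hy => ?_⟩
  have hsub : uIcc x y ⊆ I := hI.uIcc_subset hx hy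
  exact (intervalIntegral.integral_eq_sub_of_hasDerivAt (fun t ht => hf t (hsub ht))
    (hf'.mono hsub).intervalIntegrable).symm

lemma ACPunctured_of_hasDerivAt {f f' : ℝ → ℂ} (hf : ∀ x ≠ 0, HasDerivAt f (f' x) x)
    (hf' : ∀ x ≠ 0, ContinuousAt f' x) : ACPunctured f :=
  ⟨AC_of_hasDerivAt ordConnected_Iio (fun x hx => hf x hx.ne)
      fun x hx => (hf' x hx.ne).continuousWithinAt,
    AC_of_hasDerivAt ordConnected_Ioi (fun x hx => hf x hx.ne')
      fun x hx => (hf' x hx.ne').continuousWithinAt⟩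

lemma ordConnected_timeInterval (T : EReal) : (timeInterval T).OrdConnected :=
  ⟨fun _ hx _ hy _ hz =>
    ⟨hx.1.trans_le hz.1, (EReal.coe_le_coe_iff.2 hz.2).trans_lt hy.2⟩⟩

section Equation

variable {ν : ℂ} {t x : ℝ} {z : ℂ} (hν : |ν.re| < 1 / 2) (hz : z.re ≠ 0)
include hν hz

lemma hasDerivAt_greenExt_space (ht : 0 < t) (hx : x ≠ 0) :
    HasDerivAt (fun ξ => greenExt ν t ξ z) (truncate (kernelX ν) t x z) x :=
  hasDerivAt_truncate_space hx hz fun hxz => hasDerivAt_kernel_space hν ht hxz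

lemma hasDerivAt_deriv_greenExt_space (ht : 0 < t) (hx : x ≠ 0) :
    HasDerivAt (deriv fun ξ => greenExt ν t ξ z) (truncate (kernelXX ν) t x z) x :=
  hasDerivAt_deriv_of_ne_zero (fun _ hξ => hasDerivAt_greenExt_space hν hz ht hξ)
    (hasDerivAt_truncate_space hx hz fun hxz => hasDerivAt_kernelX hν ht hxz) hx

omit hz in
lemma hasDerivAt_greenExt_time (ht : 0 < t) :
    HasDerivAt (fun τ => greenExt ν τ x z) (truncate (kernelT ν) t x z) t :=
  hasDerivAt_truncate_time fun hxz => hasDerivAt_kernel_time hν ht hxz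

lemma differentiableAt_greenExt (ht : 0 < t) (hx : x ≠ 0) :
    DifferentiableAt ℂ (greenExt ν t x) z :=
  differentiableAt_truncate hx hz fun hxz => differentiableAt_kernel hν ht hxz

lemma AC12_greenExt (T : EReal) : AC12 T fun t x => greenExt ν t x z := by
  refine ⟨fun x _ => ?_, fun t ht => ⟨?_, ?_⟩⟩
  · exact AC_of_hasDerivAt (ordConnected_timeInterval T)
      (fun t ht => hasDerivAt_greenExt_time hν ht.1)
      fun t ht => (continuousAt_truncate_time fun hxz =>
        continuousAt_kernelT hν ht.1 hxz).continuousWithinAt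
  · exact ACPunctured_of_hasDerivAt (fun x hx => hasDerivAt_greenExt_space hν hz ht.1 hx)
      fun x hx => continuousAt_truncate_space hx hz fun hxz =>
        (hasDerivAt_kernelX hν ht.1 hxz).continuousAt
  · exact ACPunctured_of_hasDerivAt (fun x hx => hasDerivAt_deriv_greenExt_space hν hz ht.1 hx)
      fun x hx => continuousAt_truncate_space hx hz fun hxz => continuousAt_kernelXX hν ht.1 hxz

lemma solvesSchroedinger_greenExt {lam : ℝ} (hlam : ν ^ 2 = ((1 / 4 + lam : ℝ) : ℂ)) (T : EReal) :
    SolvesSchroedinger T (fun _ x => ((lam / x ^ 2 : ℝ) : ℂ)) fun t x => greenExt ν t x z := by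
  refine Eventually.of_forall fun ⟨t, x⟩ ht hx => ?_
  have htime := hasDerivAt_greenExt_time (x := x) (z := z) hν ht.1
  have hspace := hasDerivAt_deriv_greenExt_space hν hz ht.1 hx
  refine ⟨htime.differentiableAt, (hasDerivAt_greenExt_space hν hz ht.1 hx).differentiableAt,
    hspace.differentiableAt, ?_⟩
  have hcoeff : ν ^ 2 - 1 / 4 = lam := by rw [hlam]; push_cast; ring
  rw [htime.deriv, hspace.deriv, greenExt]
  simp only [truncate]
  split_ifs with hxz
  · rw [kernel_schroedinger ht.1 hxz, hcoeff]
    push_cast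
    rfl
  · rw [mul_zero, mul_zero, neg_zero, zero_add]

end Equation

lemma order_sq (lam : ℝ) : order lam ^ 2 = ((1 / 4 + lam : ℝ) : ℂ) :=
  Complex.cpow_nat_inv_pow _ two_ne_zero

lemma order_re (lam : ℝ) : (order lam).re = Real.sqrt (1 / 4 + lam) := Complex.re_sqrt_ofReal

lemma abs_order_re_lt {lam : ℝ} (hlam : lam < 0) : |(order lam).re| < 1 / 2 := by
  rw [order_re, abs_of_nonneg (Real.sqrt_nonneg _), Real.sqrt_lt' (by norm_num)]
  linarith

lemma order_im_eq_zero {lam : ℝ} (h : -(1 / 4) ≤ lam) : (order lam).im = 0 := by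
  rw [order, Complex.sqrt_of_nonneg (by exact_mod_cast by linarith), Complex.ofReal_im]

lemma order_re_eq_zero {lam : ℝ} (h : lam < -(1 / 4)) : (order lam).re = 0 := by
  rw [order_re, Real.sqrt_eq_zero_of_nonpos (by linarith)]

lemma sqrt_I_mul_pi :
    Complex.sqrt (Complex.I * Real.pi) = Complex.I ^ (1 / 2 : ℂ) * (Real.sqrt Real.pi : ℂ) := by
  rw [Complex.sqrt, I_mul_ofReal_cpow Real.pi_pos, ofReal_sqrt_eq_cpow Real.pi_pos.le, one_div]

lemma kernelConst_eq (ν : ℂ) :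
    kernelConst ν = (Real.sqrt 2 : ℂ) * hankelConst ν / (4 * Complex.I ^ (ν + 1)) := by
  have hadd : Complex.I ^ (ν + 1) = Complex.I ^ (ν + 1 / 2) * Complex.I ^ (1 / 2 : ℂ) := by
    rw [← Complex.cpow_add _ _ Complex.I_ne_zero, add_assoc, add_halves]
  have htwo : (Real.sqrt 2 : ℂ) ^ 2 = 2 := by
    rw [← Complex.ofReal_pow, Real.sq_sqrt zero_le_two, Complex.ofReal_ofNat]
  rw [kernelConst, hankelConst, sqrt_I_mul_pi, hadd]
  field_simp
  rw [htwo]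
  norm_num

lemma chirp_eq_exp_mul_exp_neg_phase {t : ℝ} (ht : t ≠ 0) (x : ℝ) (z : ℂ) :
    chirp t x z =
      Complex.exp (-((x : ℂ) ^ 2 + z ^ 2) / (4 * Complex.I * t)) * Complex.exp (-phase t x z) := by
  have ht0 : (t : ℂ) ≠ 0 := Complex.ofReal_ne_zero.2 ht
  rw [chirp, ← Complex.exp_add, phase]
  congr 1
  field_simp
  rw [Complex.I_sq]
  ring

lemma kernel_ofReal {ν : ℂ} (hν : |ν.re| < 1 / 2) {t x y : ℝ} (ht : 0 < t) (hxy : 0 < x * y) :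
    kernel ν t x y = (Real.sqrt (x * y) : ℂ) / (4 * Complex.I ^ (ν + 1) * t) *
      Complex.exp (-((x : ℂ) ^ 2 + (y : ℂ) ^ 2) / (4 * Complex.I * t)) *
      hankelH2 ν ((x : ℂ) * y / (2 * t)) := by
  have hst : (Real.sqrt t : ℂ) ≠ 0 := Complex.ofReal_ne_zero.2 (Real.sqrt_pos.2 ht).ne'
  have hsq : (t : ℂ) = (Real.sqrt t : ℂ) ^ 2 := by rw [← Complex.ofReal_pow, Real.sq_sqrt ht.le]
  set w : ℝ := x * y / (2 * t) with hw
  have hw0 : 0 < w := by positivity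
  have hwc : (w : ℂ) = (x : ℂ) * y / (2 * t) := by push_cast [hw]; rfl
  have hxyw : (Real.sqrt (x * y) : ℂ) =
      (Real.sqrt 2 : ℂ) * (Real.sqrt t : ℂ) * (Real.sqrt w : ℂ) := by
    rw [← Complex.ofReal_mul, ← Complex.ofReal_mul, ← Real.sqrt_mul zero_le_two,
      ← Real.sqrt_mul (by positivity), mul_div_cancel₀ _ (by positivity)]
  set gauss := Complex.exp (-((x : ℂ) ^ 2 + (y : ℂ) ^ 2) / (4 * Complex.I * t))
  calc kernel ν t x y
      = gauss * (kernelConst ν / (Real.sqrt t : ℂ) * decaying (ν - 1 / 2) (Complex.I * w)) := by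
        rw [kernel, chirp_eq_exp_mul_exp_neg_phase ht.ne', profile, amplitude, decaying, hwc,
          ← phase]
        ring
    _ = gauss * ((Real.sqrt 2 : ℂ) / (4 * Complex.I ^ (ν + 1) * (Real.sqrt t : ℂ)) *
          ((Real.sqrt w : ℂ) * hankelH2 ν w)) := by
        rw [sqrt_mul_hankelH2 hν hw0, kernelConst_eq]
        field_simp
    _ = _ := by
        rw [hxyw, ← hwc, hsq]
        field_simp

lemma greenExt_ofReal {lam : ℝ} (hlam : lam < 0) {t : ℝ} (ht : 0 < t) (x y : ℝ) :
    greenExt (order lam) t x y = greenFunction lam t x y := by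
  rw [greenExt, truncate, greenFunction, step, Complex.ofReal_re]
  split_ifs with hxy
  · rw [kernel_ofReal (abs_order_re_lt hlam) ht hxy, one_mul]
  · simp only [zero_mul, Complex.ofReal_zero, zero_div]

lemma rayBound_phase_ofReal (t x y : ℝ) : RayBound 1 (phase t x y) :=
  rayBound_one (phase_ofReal_re t x y).ge

lemma tendsto_greenExt_zero {ν : ℂ} (hν : |ν.re| < 1 / 2) {t : ℝ} (ht : 0 < t) (y : ℝ) :
    Tendsto (fun x => greenExt ν t x y) (𝓝[≠] 0) (𝓝 0) := by
  have hslit : ∀ᶠ x in 𝓝[≠] 0 ⊓ 𝓟 {x : ℝ | 0 < x * (y : ℂ).re},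
      phase t x y ∈ Complex.slitPlane :=
    eventually_inf_principal.2 (Eventually.of_forall fun x hx => phase_mem_slitPlane ht hx)
  have hphase : Tendsto (fun x => phase t x y) (𝓝[≠] 0) (𝓝 0) := by
    have hcont : Continuous fun x => phase t x y := by unfold phase; fun_prop
    simpa [phase] using (hcont.tendsto 0).mono_left nhdsWithin_le_nhds
  have hchirp : Tendsto (fun x => chirp t x y) (𝓝[≠] 0) (𝓝 (chirp t 0 y)) :=
    (hasDerivAt_chirp_space t 0 y).continuousAt.tendsto.mono_left nhdsWithin_le_nhds
  have hlaplace := tendsto_laplaceInt_zero one_pos (neg_one_lt_re_sub_half hν)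
    (re_sub_half_neg hν) hslit (Eventually.of_forall fun x => rayBound_phase_ofReal t x y)
    (hphase.mono_left inf_le_left)
  refine Tendsto.if ?_ tendsto_const_nhds
  simpa [kernel, profile] using
    (hchirp.mono_left inf_le_left).mul (hlaplace.const_mul (amplitude ν t))

lemma transmission_greenFunction {lam : ℝ} (hlam : lam < 0) {t : ℝ} (ht : 0 < t) (y : ℝ) :
    Transmission 1 0 fun x => greenFunction lam t x y := by
  have hlim := tendsto_greenExt_zero (abs_order_re_lt hlam) ht y
  simp only [greenExt_ofReal hlam ht] at hlim
  exact ⟨0, 0, 0, 0, fun _ => ⟨hlim.mono_left (nhdsGT_le_nhdsNE 0),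
    hlim.mono_left (nhdsLT_le_nhdsNE 0)⟩, fun h => absurd rfl h, by simp⟩

lemma sqrt_one_div_four_mul (t : ℝ) : Real.sqrt (1 / (4 * t)) = (2 * Real.sqrt t)⁻¹ := by
  rw [one_div, Real.sqrt_inv, Real.sqrt_mul zero_le_four, show (4 : ℝ) = 2 ^ 2 by norm_num,
    Real.sqrt_sq zero_le_two]

lemma kernel_div_sqrt (ν : ℂ) {t : ℝ} (ht : 0 < t) (x : ℝ) :
    kernel ν t x x / (Real.sqrt (1 / (4 * t)) : ℂ) =
      2 * kernelConst ν * laplaceInt (ν - 1 / 2) (ν - 1 / 2) (phase t x x) := by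
  have hst : (Real.sqrt t : ℂ) ≠ 0 := Complex.ofReal_ne_zero.2 (Real.sqrt_pos.2 ht).ne'
  have hchirp : chirp t x x = 1 := by simp [chirp]
  rw [kernel, hchirp, profile, amplitude, sqrt_one_div_four_mul, Complex.ofReal_inv,
    Complex.ofReal_mul, Complex.ofReal_ofNat]
  field_simp

lemma tendsto_greenFunction_diagonal {lam : ℝ} (hlam : lam < 0) {x : ℝ} (hx : x ≠ 0) :
    Tendsto (fun t : ℝ => greenFunction lam t x x / (Real.sqrt (1 / (4 * t)) : ℂ)) (𝓝[>] 0)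
      (𝓝 (1 / Complex.sqrt (Complex.I * Real.pi))) := by
  have hν := abs_order_re_lt hlam
  set ν := order lam
  have hxx : 0 < x * (x : ℂ).re := mul_self_pos.2 hx
  have hphase : Tendsto (fun t => (phase t x x)⁻¹) (𝓝[>] 0) (𝓝 0) := by
    have hcont : Continuous fun t : ℝ => 2 * (t : ℂ) / (Complex.I * (x * x)) := by fun_prop
    have hlim := (hcont.tendsto 0).mono_left (nhdsWithin_le_nhds (s := Ioi 0))
    rw [Complex.ofReal_zero, mul_zero, zero_div] at hlim
    exact hlim.congr fun t => by rw [phase, ← mul_div_assoc, inv_div]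
  have hlaplace := tendsto_laplaceInt_Gamma one_pos (neg_one_lt_re_sub_half hν)
    (re_sub_half_neg hν).le
    (eventually_mem_nhdsWithin.mono fun t (ht : t ∈ Ioi 0) => phase_mem_slitPlane ht hxx)
    (Eventually.of_forall fun t => rayBound_phase_ofReal t x x) hphase
  have hconst : 2 * kernelConst ν * Complex.Gamma (ν - 1 / 2 + 1) =
      1 / Complex.sqrt (Complex.I * Real.pi) := by
    have hΓ := Gamma_add_half_ne_zero (abs_lt.1 hν).1
    rw [show ν - 1 / 2 + 1 = ν + 1 / 2 by ring, kernelConst]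
    generalize Complex.Gamma (ν + 1 / 2) = Γ at hΓ ⊢
    field_simp
  rw [← hconst]
  refine (hlaplace.const_mul (2 * kernelConst ν)).congr' ?_
  filter_upwards [self_mem_nhdsWithin] with t ht
  rw [← greenExt_ofReal hlam ht, greenExt, truncate, if_pos hxx, kernel_div_sqrt ν ht]

/-! ### Exponential bounds -/

lemma cos_mul_norm_le_re {α : ℝ} (hα : α ≤ Real.pi) {z : ℂ} (hz : Complex.arg z ∈ Icc (-α) α) :
    Real.cos α * ‖z‖ ≤ z.re := by
  rw [← Complex.norm_mul_cos_arg z, mul_comm, ← Real.cos_abs z.arg]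
  exact mul_le_mul_of_nonneg_left
    (Real.cos_le_cos_of_nonneg_of_le_pi (abs_nonneg _) hα (abs_le.2 hz)) (norm_nonneg z)

lemma cos_mul_norm_le_abs_re_of_mem_domainD {α h : ℝ} (hα : α ≤ Real.pi) {z : ℂ}
    (hz : z ∈ domainD α h) : Real.cos α * ‖z‖ ≤ |z.re| := by
  rcases hz with ⟨-, harg, -⟩ | ⟨-, harg, -⟩
  · exact (cos_mul_norm_le_re hα harg).trans (le_abs_self _)
  · simpa using (cos_mul_norm_le_re hα harg).trans (le_abs_self _)

section Bounds

variable {α h : ℝ} (hα : α ∈ Ioo (0 : ℝ) (Real.pi / 2))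
include hα

lemma cos_pos_of_mem_Ioo_zero_pi_div_two : 0 < Real.cos α :=
  Real.cos_pos_of_mem_Ioo ⟨by linarith [hα.1, Real.pi_pos], hα.2⟩

lemma re_ne_zero_of_mem_domainD {z : ℂ} (hz : z ∈ domainD α h) : z.re ≠ 0 := by
  have hz0 : z ≠ 0 := hz.elim And.left And.left
  have hpos := mul_pos (cos_pos_of_mem_Ioo_zero_pi_div_two hα) (norm_pos_iff.2 hz0)
  exact abs_pos.1 <| hpos.trans_le <|
    cos_mul_norm_le_abs_re_of_mem_domainD (by linarith [hα.2, Real.pi_pos]) hz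

lemma rayBound_phase {z : ℂ} (hz : z ∈ domainD α h) {t x : ℝ} (ht : 0 < t) (hxz : 0 < x * z.re) :
    RayBound (Real.cos α) (phase t x z) := by
  refine rayBound_of_le_abs_im (Complex.slitPlane_ne_zero (phase_mem_slitPlane ht hxz)) ?_
  have hnorm : ‖phase t x z‖ = |x| / (2 * t) * ‖z‖ := by
    rw [phase, norm_mul, Complex.norm_I, norm_div, norm_mul, norm_mul, Complex.norm_ofNat,
      Complex.norm_real, Complex.norm_real, Real.norm_eq_abs, Real.norm_of_nonneg ht.le]
    ring
  have him : |(phase t x z).im| = |x| / (2 * t) * |z.re| := by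
    rw [phase_im, abs_div, abs_mul, abs_of_pos (by positivity : 0 < 2 * t)]
    ring
  rw [hnorm, him, mul_left_comm]
  exact mul_le_mul_of_nonneg_left
    (cos_mul_norm_le_abs_re_of_mem_domainD (by linarith [hα.2, Real.pi_pos]) hz) (by positivity)

lemma exists_norm_profile_le {ν : ℂ} (hν : |ν.re| < 1 / 2) :
    ∃ M, 0 ≤ M ∧ ∀ h t x : ℝ, 0 < t → ∀ z ∈ domainD α h, 0 < x * z.re →
      ‖profile ν t x z‖ ≤ ‖amplitude ν t‖ * M ∧
      ‖profileX ν t x z‖ ≤ ‖amplitude ν t‖ / |x| * M ∧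
      ‖profileXX ν t x z‖ ≤ ‖amplitude ν t‖ / x ^ 2 * M ∧
      ‖profileT ν t x z‖ ≤ ‖amplitude ν t‖ / t * (2 * M) := by
  obtain ⟨M, hM, hbound⟩ := exists_laplace_bound (neg_one_lt_re_sub_half hν)
    (re_sub_half_neg hν).le (cos_pos_of_mem_Ioo_zero_pi_div_two hα)
  refine ⟨M, hM, fun h t x ht z hz hxz => ?_⟩
  obtain ⟨hk, hk', hk''⟩ := hbound _ (phase_mem_slitPlane ht hxz) (rayBound_phase hα hz ht hxz)
  refine ⟨?_, ?_, ?_, ?_⟩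
  · rw [profile, norm_mul]
    gcongr
  · rw [profileX, norm_mul, norm_div, Complex.norm_real, Real.norm_eq_abs]
    gcongr
  · rw [profileXX, norm_mul, norm_div, norm_pow, Complex.norm_real, Real.norm_eq_abs, sq_abs]
    gcongr
  · rw [profileT, norm_mul, norm_neg, norm_div, Complex.norm_real, Real.norm_of_nonneg ht.le]
    gcongr
    refine (norm_add_le _ _).trans ?_
    rw [norm_div, Complex.norm_ofNat]
    linarith

end Bounds

lemma reduced_greenExt (ν : ℂ) :
    reduced (fun t => 1 / (4 * t)) (greenExt ν) = truncate (profile ν) := by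
  funext t x z
  rw [reduced, greenExt, truncate, truncate]
  split_ifs
  · rw [kernel, chirp, ← mul_assoc, ← Complex.exp_add]
    push_cast
    ring_nf
    rw [Complex.exp_zero, one_mul]
  · rw [mul_zero]

lemma exists_norm_reduced_greenExt_le {ν : ℂ} (hν : |ν.re| < 1 / 2) {α : ℝ}
    (hα : α ∈ Ioo (0 : ℝ) (Real.pi / 2)) :
    ∃ M, 0 ≤ M ∧ ∀ h t x : ℝ, 0 < t → x ≠ 0 → ∀ z ∈ domainD α h,
      ‖reduced (fun t => 1 / (4 * t)) (greenExt ν) t x z‖ ≤ ‖amplitude ν t‖ * M ∧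
      ‖deriv (fun ξ => reduced (fun t => 1 / (4 * t)) (greenExt ν) t ξ z) x‖ ≤
        ‖amplitude ν t‖ / |x| * M ∧
      ‖deriv (deriv fun ξ => reduced (fun t => 1 / (4 * t)) (greenExt ν) t ξ z) x‖ ≤
        ‖amplitude ν t‖ / x ^ 2 * M ∧
      ‖deriv (fun τ => reduced (fun t => 1 / (4 * t)) (greenExt ν) τ x z) t‖ ≤
        ‖amplitude ν t‖ / t * (2 * M) := by
  obtain ⟨M, hM, hbound⟩ := exists_norm_profile_le hα hν
  refine ⟨M, hM, fun h t x ht hx z hz => ?_⟩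
  have hzr := re_ne_zero_of_mem_domainD hα hz
  have hspace : ∀ ξ ≠ 0, HasDerivAt (fun ξ => truncate (profile ν) t ξ z)
      (truncate (profileX ν) t ξ z) ξ := fun ξ hξ =>
    hasDerivAt_truncate_space hξ hzr fun hxz => hasDerivAt_profile_space hν ht hxz
  have hspace2 := hasDerivAt_deriv_of_ne_zero hspace
    (hasDerivAt_truncate_space hx hzr fun hxz => hasDerivAt_profileX hν ht hxz) hx
  have htime : HasDerivAt (fun τ => truncate (profile ν) τ x z) (truncate (profileT ν) t x z) t :=
    hasDerivAt_truncate_time fun hxz => hasDerivAt_profile_time hν ht hxz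
  rw [reduced_greenExt, (hspace x hx).deriv, hspace2.deriv, htime.deriv]
  exact ⟨norm_truncate_le (by positivity) fun hxz => (hbound h t x ht z hz hxz).1,
    norm_truncate_le (by positivity) fun hxz => (hbound h t x ht z hz hxz).2.1,
    norm_truncate_le (by positivity) fun hxz => (hbound h t x ht z hz hxz).2.2.1,
    norm_truncate_le (by positivity) fun hxz => (hbound h t x ht z hz hxz).2.2.2⟩

lemma norm_amplitude_div_sqrt (ν : ℂ) {t : ℝ} (ht : 0 < t) :
    ‖amplitude ν t‖ / Real.sqrt (1 / (4 * t)) = 2 * ‖kernelConst ν‖ := by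
  have hst : 0 < Real.sqrt t := Real.sqrt_pos.2 ht
  rw [amplitude, norm_div, Complex.norm_real, Real.norm_of_nonneg hst.le, sqrt_one_div_four_mul]
  field_simp

lemma continuousOn_norm_amplitude (ν : ℂ) (T : EReal) :
    ContinuousOn (fun p : ℝ × ℝ => ‖amplitude ν p.1‖) (timeInterval T ×ˢ {0}ᶜ) := fun _ hp =>
  ((hasDerivAt_amplitude ν hp.1.1).continuousAt.comp continuousAt_fst).norm.continuousWithinAt

lemma isCoefficient_zero (T : EReal) : IsCoefficient T fun _ _ => 0 :=
  ⟨fun _ _ _ _ => le_rfl, continuousOn_const⟩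

lemma isCoefficient_spaceBound (ν : ℂ) (T : EReal) {M : ℝ} (hM : 0 ≤ M) :
    IsCoefficient T fun t x => ‖amplitude ν t‖ / |x| * M :=
  ⟨fun _ _ _ _ => by positivity, ((continuousOn_norm_amplitude ν T).div (by fun_prop)
    fun _ hp => abs_ne_zero.2 hp.2).mul continuousOn_const⟩

lemma isCoefficient_secondOrderBound (ν : ℂ) (T : EReal) {M : ℝ} (hM : 0 ≤ M) :
    IsCoefficient T fun t x => ‖amplitude ν t‖ / x ^ 2 * M + ‖amplitude ν t‖ / t * (2 * M) := by
  have hamp := continuousOn_norm_amplitude ν T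
  refine ⟨fun t ht x _ => ?_, ?_⟩
  · have := ht.1
    positivity
  · exact ((hamp.div (by fun_prop) fun _ hp => pow_ne_zero 2 hp.2).mul continuousOn_const).add
      ((hamp.div (by fun_prop) fun _ hp => hp.1.1.ne').mul continuousOn_const)

lemma exponentialBounds_greenExt {ν : ℂ} (hν : |ν.re| < 1 / 2) (T : EReal)
    (M : Matrix (Fin 2) (Fin 2) ℂ) {α : ℝ} (hα : α ∈ Ioo (0 : ℝ) (Real.pi / 2)) (h : ℝ) :
    ExponentialBounds T M 0 (domainD α h) (greenExt ν) (fun t => 1 / (4 * t)) 1 := by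
  obtain ⟨C, hC, hbound⟩ := exists_norm_reduced_greenExt_le hν hα
  have hzero := isCoefficient_zero T
  have hA₀ : IsCoefficient T fun t _ => ‖amplitude ν t‖ * C :=
    ⟨fun _ _ _ _ => by positivity, (continuousOn_norm_amplitude ν T).mul continuousOn_const⟩
  refine ⟨_, _, _, fun _ _ => 0, fun _ _ => 0, fun _ _ => 0, ⟨hA₀, isCoefficient_spaceBound ν T hC,
    isCoefficient_secondOrderBound ν T hC, hzero, hzero, hzero⟩, ?_, ?_, ?_⟩
  · intro t ht x hx z hz
    have ht0 : 0 < t := ht.1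
    obtain ⟨hle, hspace, hspace2, htime⟩ := hbound h t x ht0 hx z hz
    simp only [zero_mul, Real.exp_zero, mul_one]
    exact ⟨hle, hspace, hspace2.trans (le_add_of_nonneg_right (by positivity)),
      htime.trans (le_add_of_nonneg_left (by positivity))⟩
  · refine fun x _ => ⟨isBoundedUnder_of_eventually_le (a := 2 * ‖kernelConst ν‖ * C) ?_,
      isBoundedUnder_const⟩
    filter_upwards [self_mem_nhdsWithin] with t ht
    rw [mul_div_right_comm, norm_amplitude_div_sqrt ν ht]
  · exact fun t _ => ⟨fun _ => ⟨isBoundedUnder_const, isBoundedUnder_const⟩,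
      fun hN => absurd rfl hN⟩

lemma AC_one_div_four_mul (T : EReal) : AC (fun t : ℝ => 1 / (4 * t)) (timeInterval T) := by
  refine AC_of_hasDerivAt (f' := fun t => 1 / 4 * -(t ^ 2)⁻¹) (ordConnected_timeInterval T)
    (fun t ht => ?_) (continuousOn_const.mul (ContinuousOn.inv₀ (by fun_prop)
      fun t ht => pow_ne_zero 2 ht.1.ne').neg)
  simpa only [one_div_mul_eq_div, one_div, mul_inv] using
    (hasDerivAt_inv ht.1.ne').const_mul (1 / 4 : ℝ)

lemma tendsto_one_div_four_mul : Tendsto (fun t : ℝ => 1 / (4 * t)) (𝓝[>] 0) atTop := by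
  simp only [one_div, mul_inv]
  exact tendsto_inv_nhdsGT_zero.const_mul_atTop (by norm_num)

end CentrifugalGreen

end

theorem proposition5p1 (lam : ℝ) (hlam : lam < 0) :
    (-(1 / 4) ≤ lam → (CentrifugalGreen.order lam).im = 0) ∧
    (lam < -(1 / 4) → (CentrifugalGreen.order lam).re = 0) ∧
    ∀ (T : EReal), 0 < T → ∀ α ∈ Set.Ioo (0 : ℝ) (Real.pi / 2), ∀ h : ℝ, 0 < h →
      CentrifugalGreen.GreenAssumption T (fun _ x => ((lam / x ^ 2 : ℝ) : ℂ)) 1 0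
        (CentrifugalGreen.domainD α h) (CentrifugalGreen.greenFunction lam) := by
  refine ⟨CentrifugalGreen.order_im_eq_zero, CentrifugalGreen.order_re_eq_zero,
    fun T _ α hα h _ => ?_⟩
  have hν := CentrifugalGreen.abs_order_re_lt hlam
  have hre {z : ℂ} (hz : z ∈ CentrifugalGreen.domainD α h) : z.re ≠ 0 :=
    CentrifugalGreen.re_ne_zero_of_mem_domainD hα hz
  have hdiff {t : ℝ} (ht : t ∈ CentrifugalGreen.timeInterval T) {x : ℝ} (hx : x ≠ 0) {z : ℂ}
      (hz : z ∈ CentrifugalGreen.domainD α h) :=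
    CentrifugalGreen.differentiableAt_greenExt hν (hre hz) ht.1 hx
  refine ⟨CentrifugalGreen.greenExt (CentrifugalGreen.order lam), fun t ht x hx =>
      ⟨fun y _ => CentrifugalGreen.greenExt_ofReal hlam ht.1 x y, fun z hz =>
        (hdiff ht hx hz).continuousAt.continuousWithinAt, fun z hz =>
        (hdiff ht hx (interior_subset hz)).differentiableWithinAt⟩,
    fun z hz => ⟨CentrifugalGreen.AC12_greenExt hν (hre hz) T,
      CentrifugalGreen.solvesSchroedinger_greenExt hν (hre hz)
        (CentrifugalGreen.order_sq lam) T⟩,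
    fun y _ t ht => CentrifugalGreen.transmission_greenFunction hlam ht.1 y,
    fun t => 1 / (4 * t), CentrifugalGreen.AC_one_div_four_mul T,
    fun t ht => one_div_pos.2 (mul_pos four_pos ht.1),
    CentrifugalGreen.tendsto_one_div_four_mul,
    fun x hx => CentrifugalGreen.tendsto_greenFunction_diagonal hlam hx,
    1, by norm_num, CentrifugalGreen.exponentialBounds_greenExt hν T 1 hα h⟩
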